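/- Let $K$ be a field and let $\ell\ge n\ge 1$ be integers. The nilHecke algebra $H_n$ is the unital associative $K$-algebra with generators $\psi_1,\dots,\psi_{n-1},y_1,\dots,y_n$ and relations $$\psi_r^2=0,\qquad \psi_r\psi_k=\psi_k\psi_r\ (k<r-1),\qquad \psi_r\psi_{r+1}\psi_r=\psi_{r+1}\psi_r\psi_{r+1},\qquad y_ry_k=y_ky_r,$$ $$\psi_ry_{r+1}=y_r\psi_r+1,\qquad y_{r+1}\psi_r=\psi_ry_r+1,\qquad \psi_ry_k=y_k\psi_r\ (k\ne r,r+1),$$ and the cyclotomic nilHecke algebra $H_{\ell,n}^{(0)}$ is the quotient of $H_n$ by the two-sided ideal generated by $y_1^\ell$; let $\pi_\ell:H_n\to H_{\ell,n}^{(0)}$ be the natural surjection, and write $y_k$ also for $\pi_\ell(y_k)$. For $w$ in the symmetric group $\mathfrak S_n$ with reduced expression $w=s_{i_1}\cdots s_{i_k}$, where $s_i=(i,i+1)$, put $\psi_w=\psi_{i_1}\cdots\psi_{i_k}$, and let $w_0$ be the longest element of $\mathfrak S_n$. Let $J_n=\sum_{r=1}^{n-1}\psi_rH_n$. For a partition $\mu=(\mu_1\ge\dots\ge\mu_n\ge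 0)$ let $$S_\mu=(-1)^{n(n-1)/2}\,y_1^{\mu_1+n-1}y_2^{\mu_2+n-2}\cdots y_n^{\mu_n}\,\psi_{w_0}\in H_n,$$ let $z(\mu)\in H_n$ be the unique symmetric polynomial in $y_1,\dots,y_n$ such that $S_\mu\equiv z(\mu)\pmod{J_n}$, and let $z_\mu=\pi_\ell(z(\mu))$. Let $s_\mu=a_{\mu+\delta}/a_\delta\in K[x_1,\dots,x_n]$ be the Schur polynomial, where $a_c=\sum_{w\in\mathfrak S_n}(-1)^{\ell(w)}x^{w(c)}$, $\ell(w)$ is the length of $w$, and $\delta=(n-1,\dots,1,0)$. Let $P_{\ell,n}$ be the set of integer tuples $\lambda=(\lambda_1,\dots,\lambda_n)$ with $1\le\lambda_1<\dots<\lambda_n\le\ell$, and for $\lambda\in P_{\ell,n}$ let $\rho(\lambda)$ be the partition with $\rho(\lambda)_i=\ell-\lambda_i-n+i$ for $1\le i\le n$. Then for each $\lambda\in P_{\ell,n}$ the element $z(\rho(\lambda))$ is well defined (it exists and is unique), and $$z_{\rho(\lambda)}=s_{\rho(\lambda)}(y_1,\dots,y_n)\quad\text{in }H_{\ell,n}^{(0)}.$$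 In particular, the elements $s_{\rho(\lambda)}(y_1,\dots,y_n)$, $\lambda\in P_{\ell,n}$, form a $K$-basis of the center of $H_{\ell,n}^{(0)}$. -/

import Mathlib

noncomputable section

namespace NilHecke

/-! Indices are shifted by one throughout: `r : Fin (n - 1)` stands for the index `r + 1` of
`ψ` (or of a simple transposition), and `k : Fin n` stands for the index `k + 1` of `y`. -/

/-- The generators `ψ_1, …, ψ_{n-1}, y_1, …, y_n`. -/
inductive Gen (n : ℕ) : Type
  | psi (r : Fin (n - 1)) : Gen n
  | y (k : Fin n) : Gen n

/-- The index `r`, viewed as an index of a `y`. -/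
def lo {n : ℕ} (r : Fin (n - 1)) : Fin n := ⟨r.val, by omega⟩

/-- The index `r + 1`, viewed as an index of a `y`. -/
def hi {n : ℕ} (r : Fin (n - 1)) : Fin n := ⟨r.val + 1, by omega⟩

section Algebras

variable (K : Type*) [Field K] {n : ℕ}

/-- The free generator `ψ_r`. -/
def fpsi (r : Fin (n - 1)) : FreeAlgebra K (Gen n) := FreeAlgebra.ι K (Gen.psi r)

/-- The free generator `y_k`. -/
def fy (k : Fin n) : FreeAlgebra K (Gen n) := FreeAlgebra.ι K (Gen.y k)

/-- The defining relations of the nilHecke algebra of type `A`. -/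
inductive Rel : FreeAlgebra K (Gen n) → FreeAlgebra K (Gen n) → Prop
  | psi_sq (r : Fin (n - 1)) : Rel (fpsi K r ^ 2) 0
  | psi_comm (r k : Fin (n - 1)) (h : k.val + 1 < r.val) :
      Rel (fpsi K r * fpsi K k) (fpsi K k * fpsi K r)
  | braid (r r' : Fin (n - 1)) (h : r'.val = r.val + 1) :
      Rel (fpsi K r * fpsi K r' * fpsi K r) (fpsi K r' * fpsi K r * fpsi K r')
  | y_comm (r k : Fin n) : Rel (fy K r * fy K k) (fy K k * fy K r)
  | psi_y_hi (r : Fin (n - 1)) :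
      Rel (fpsi K r * fy K (hi r)) (fy K (lo r) * fpsi K r + 1)
  | y_hi_psi (r : Fin (n - 1)) :
      Rel (fy K (hi r) * fpsi K r) (fpsi K r * fy K (lo r) + 1)
  | psi_y (r : Fin (n - 1)) (k : Fin n) (h₁ : k ≠ lo r) (h₂ : k ≠ hi r) :
      Rel (fpsi K r * fy K k) (fy K k * fpsi K r)

variable (n) in
/-- The nilHecke algebra `H_n` of type `A` over `K`. -/
abbrev Alg : Type _ := RingQuot (Rel K (n := n))

/-- The element `ψ_r` of `H_n`. -/
def psi (r : Fin (n - 1)) : Alg K n := RingQuot.mkAlgHom K (Rel K) (fpsi K r)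

/-- The element `y_k` of `H_n`. -/
def y (k : Fin n) : Alg K n := RingQuot.mkAlgHom K (Rel K) (fy K k)

variable (n) in
/-- The two-sided ideal of `H_n` generated by `y_1 ^ ℓ`. -/
def cycIdeal (ℓ : ℕ) [NeZero n] : TwoSidedIdeal (Alg K n) :=
  TwoSidedIdeal.span {y K (0 : Fin n) ^ ℓ}

variable (n) in
/-- The cyclotomic nilHecke algebra `H_{ℓ,n} = H_n / (y_1 ^ ℓ)`. -/
abbrev CycAlg (ℓ : ℕ) [NeZero n] : Type _ := (cycIdeal K n ℓ).ringCon.Quotient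

variable (n) in
/-- The natural surjection `π_ℓ : H_n → H_{ℓ,n}`. -/
def proj (ℓ : ℕ) [NeZero n] : Alg K n →ₐ[K] CycAlg K n ℓ := (cycIdeal K n ℓ).ringCon.mkₐ K

/-- The element `y_k` of `H_{ℓ,n}`. -/
def cycY (ℓ : ℕ) [NeZero n] (k : Fin n) : CycAlg K n ℓ := proj K n ℓ (y K k)

variable (n) in
/-- `J_n = ∑_r ψ_r H_n`. -/
def J : Submodule K (Alg K n) := ⨆ r : Fin (n - 1), LinearMap.range (LinearMap.mulLeft K (psi K r))

variable {K} in
/-- The value `f(a_1, …, a_n)` of a polynomial at pairwise commuting elements of a (not necessarily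
commutative) algebra: the monomial `x_1^{m_1} ⋯ x_n^{m_n}` goes to the ordered product
`a_1^{m_1} ⋯ a_n^{m_n}`. -/
def evalAt {A : Type*} [Ring A] [Algebra K A] (a : Fin n → A) (f : MvPolynomial (Fin n) K) : A :=
  ∑ m ∈ f.support, f.coeff m • (List.ofFn fun i => a i ^ m i).prod

end Algebras

section SymmetricGroup

variable {n : ℕ}

/-- The simple transposition `s_r = (r, r+1)`. -/
def simpleRefl (r : Fin (n - 1)) : Equiv.Perm (Fin n) := Equiv.swap (lo r) (hi r)

/-- The product `s_{i_1} ⋯ s_{i_k}` of a word `i_1, …, i_k`. -/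
def wordPerm (l : List (Fin (n - 1))) : Equiv.Perm (Fin n) := (l.map simpleRefl).prod

/-- The word `l` is a reduced expression of `w`: it has product `w`, and no word with product `w`
is shorter. -/
def IsReducedExpr (w : Equiv.Perm (Fin n)) (l : List (Fin (n - 1))) : Prop :=
  wordPerm l = w ∧ ∀ l' : List (Fin (n - 1)), wordPerm l' = w → l.length ≤ l'.length

theorem exists_wordPerm_eq (w : Equiv.Perm (Fin n)) :
    ∃ l : List (Fin (n - 1)), wordPerm l = w := by
  cases n with
  | zero => exact ⟨[], Subsingleton.elim _ _⟩
  | succ m =>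
    have hw : w ∈ Submonoid.closure
        (Set.range fun i : Fin m => Equiv.swap i.castSucc i.succ) := by
      rw [Equiv.Perm.mclosure_swap_castSucc_succ]
      trivial
    induction hw using Submonoid.closure_induction with
    | mem x hx =>
      obtain ⟨i, rfl⟩ := hx
      exact ⟨[i], by simp [wordPerm, simpleRefl, lo, hi]; rfl⟩
    | one => exact ⟨[], rfl⟩
    | mul a b _ _ iha ihb =>
      obtain ⟨l, rfl⟩ := iha
      obtain ⟨l', rfl⟩ := ihb
      exact ⟨l ++ l', by simp [wordPerm]⟩

theorem exists_isReducedExpr (w : Equiv.Perm (Fin n)) :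
    ∃ l : List (Fin (n - 1)), IsReducedExpr w l := by
  classical
  have h : ∃ k : ℕ, ∃ l : List (Fin (n - 1)), wordPerm l = w ∧ l.length = k := by
    obtain ⟨l, hl⟩ := exists_wordPerm_eq w
    exact ⟨_, l, hl, rfl⟩
  obtain ⟨l, hl, hk⟩ := Nat.find_spec h
  exact ⟨l, hl, fun l' hl' => hk ▸ Nat.find_min' h ⟨l', hl', rfl⟩⟩

/-- A reduced expression of `w`. -/
def reducedExpr (w : Equiv.Perm (Fin n)) : List (Fin (n - 1)) :=
  Classical.choose (exists_isReducedExpr w)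

/-- `ψ_w = ψ_{i_1} ⋯ ψ_{i_k}` for a reduced expression `s_{i_1} ⋯ s_{i_k}` of `w`. By the braid
relations the product is the same for all reduced expressions of `w`. -/
def psiPerm (K : Type*) [Field K] (w : Equiv.Perm (Fin n)) : Alg K n :=
  ((reducedExpr w).map (psi K)).prod

variable (n) in
/-- The longest element `w_{0,n}` of the symmetric group, `k ↦ n + 1 - k`. -/
def longest : Equiv.Perm (Fin n) := Fin.revPerm

end SymmetricGroup

section Partitions

variable {n : ℕ}

variable (n) in
/-- Partitions `(λ_1 ≥ λ_2 ≥ ⋯ ≥ λ_n ≥ 0)` with at most `n` nonzero parts. -/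
def Partitions : Type := {lam : Fin n → ℕ // Antitone lam}

variable (n) in
/-- The set `P_{ℓ,n}` of tuples `1 ≤ λ_1 < λ_2 < ⋯ < λ_n ≤ ℓ`. -/
def Tuples (ℓ : ℕ) : Type := {lam : Fin n → ℕ // StrictMono lam ∧ ∀ i, 1 ≤ lam i ∧ lam i ≤ ℓ}

theorem strictMono_add_le {lam : Fin n → ℕ} (h : StrictMono lam) :
    ∀ (d : ℕ) (i j : Fin n), j.val = i.val + d → lam i + d ≤ lam j
  | 0, i, j, hij => by
    have : i = j := Fin.ext (by omega)
    simp [this]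
  | d + 1, i, j, hij => by
    have h1 := strictMono_add_le h d i ⟨i.val + d, by omega⟩ rfl
    have h2 : lam ⟨i.val + d, by omega⟩ < lam j := h (show i.val + d < j.val by omega)
    omega

/-- The map `ρ`, with `ρ(λ)_i = ℓ - λ_i - n + i` for `i = 1, …, n`. The subtraction does not
truncate, see `rho_val`. -/
def rho {ℓ : ℕ} (lam : Tuples n ℓ) : Partitions n :=
  ⟨fun i => ℓ + (i.val + 1) - (lam.1 i + n), by
    intro i j hij
    have hij' : i.val ≤ j.val := hij
    have := strictMono_add_le lam.2.1 (j.val - i.val) i j (by omega)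
    simp only
    omega⟩

theorem rho_val {ℓ : ℕ} (lam : Tuples n ℓ) (i : Fin n) :
    ((rho lam).1 i : ℤ) = (ℓ : ℤ) - lam.1 i - n + (i.val + 1) := by
  have hi0 := i.isLt
  have h1 := strictMono_add_le lam.2.1 (n - 1 - i.val) i ⟨n - 1, by omega⟩
    (show n - 1 = _ by omega)
  have h2 := (lam.2.2 ⟨n - 1, by omega⟩).2
  have : (rho lam).1 i = ℓ + (i.val + 1) - (lam.1 i + n) := rfl
  omega

theorem rho_injective {ℓ : ℕ} : Function.Injective (rho : Tuples n ℓ → Partitions n) := by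
  intro a b h
  refine Subtype.ext (funext fun i => ?_)
  have ha := rho_val a i
  have hb := rho_val b i
  rw [h] at ha
  omega

/-- `λ + δ` with `δ = (n - 1, n - 2, …, 1, 0)`. -/
def addDelta (lam : Fin n → ℕ) : Fin n → ℕ := fun i => lam i + (n - 1 - i.val)

end Partitions

section Schur

open MvPolynomial

variable (K : Type*) [Field K] {n : ℕ}

/-- The alternant `a_c(x_1, …, x_n) = ∑_w (-1)^{ℓ(w)} x^{w(c)}`. -/
def alternant (c : Fin n → ℕ) : MvPolynomial (Fin n) K :=
  ∑ w : Equiv.Perm (Fin n), Equiv.Perm.sign w • ∏ i, X (w i) ^ c i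

theorem alternant_eq_det (c : Fin n → ℕ) :
    alternant K c = (Matrix.of fun i j : Fin n => (X i : MvPolynomial (Fin n) K) ^ c j).det := by
  simp [alternant, Matrix.det_apply]

/-- Every alternant is divisible by the Vandermonde determinant: replace the powers `X ^ c j` by
their remainders modulo `∏ i, (X - x_i)`. -/
theorem vandermonde_dvd_det {R : Type*} [CommRing R] (v : Fin n → R) (c : Fin n → ℕ) :
    (Matrix.vandermonde v).det ∣ (Matrix.of fun i j : Fin n => v i ^ c j).det := by
  nontriviality R
  set P : Polynomial R := ∏ i, (Polynomial.X - Polynomial.C (v i)) with hP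
  have hmonic : P.Monic := Polynomial.monic_prod_of_monic _ _ fun i _ => Polynomial.monic_X_sub_C _
  have hdeg : P.natDegree = n := by
    rw [hP, Polynomial.natDegree_prod_of_monic _ _ fun i _ => Polynomial.monic_X_sub_C _]
    simp
  set p : Fin n → Polynomial R := fun j => (Polynomial.X ^ c j) %ₘ P with hp
  have hpdeg : ∀ j, (p j).degree < n := fun j => by
    have h := Polynomial.degree_modByMonic_lt (Polynomial.X ^ c j) hmonic
    rwa [Polynomial.degree_eq_natDegree hmonic.ne_zero, hdeg] at h
  have heval : ∀ i j, (p j).eval (v i) = v i ^ c j := fun i j => by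
    have h := congrArg (Polynomial.eval (v i))
      (Polynomial.modByMonic_add_div (Polynomial.X ^ c j) P)
    have hz : P.eval (v i) = 0 := by
      rw [hP, Polynomial.eval_prod]
      exact Finset.prod_eq_zero (Finset.mem_univ i) (by simp)
    simpa [hz] using h
  have hmul : (Matrix.of fun i j : Fin n => v i ^ c j) =
      Matrix.vandermonde v * Matrix.of fun i j : Fin n => (p j).coeff i := by
    ext i j
    rw [Matrix.mul_apply, Matrix.of_apply, ← heval i j]
    have hlt : (p j).natDegree < n ∨ p j = 0 := by
      by_cases h0 : p j = 0
      · exact Or.inr h0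
      · exact Or.inl ((Polynomial.natDegree_lt_iff_degree_lt h0).2 (hpdeg j))
    rcases hlt with hlt | h0
    · rw [Polynomial.eval_eq_sum_range' hlt, ← Fin.sum_univ_eq_sum_range
        (fun k => (p j).coeff k * v i ^ k)]
      simp [Matrix.vandermonde_apply, mul_comm]
    · simp [h0]
  rw [hmul, Matrix.det_mul]
  exact dvd_mul_right _ _

theorem alternant_delta_dvd (c : Fin n → ℕ) :
    alternant K (addDelta (0 : Fin n → ℕ)) ∣ alternant K c := by
  refine dvd_trans ?_ (alternant_eq_det K c ▸ vandermonde_dvd_det X c)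
  have h : (Matrix.of fun i j : Fin n => (X i : MvPolynomial (Fin n) K) ^
      addDelta (0 : Fin n → ℕ) j) =
      (Matrix.vandermonde (X : Fin n → MvPolynomial (Fin n) K)).submatrix id Fin.revPerm := by
    ext i j : 2
    have : addDelta (0 : Fin n → ℕ) j = (Fin.rev j).val := by
      simp only [addDelta, Pi.zero_apply, Fin.val_rev]
      omega
    simp [Matrix.vandermonde_apply, this]
  rw [alternant_eq_det, h, Matrix.det_permute']
  rcases Int.units_eq_one_or (Equiv.Perm.sign (Fin.revPerm (n := n))) with h1 | h1 <;>
    simp [h1]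

/-- The Schur polynomial `s_λ = a_{λ+δ} / a_δ`. -/
def schur (lam : Partitions n) : MvPolynomial (Fin n) K :=
  Classical.choose (alternant_delta_dvd K (addDelta lam.1))

theorem schur_spec (lam : Partitions n) :
    alternant K (addDelta lam.1) = alternant K (addDelta (0 : Fin n → ℕ)) * schur K lam :=
  Classical.choose_spec (alternant_delta_dvd K (addDelta lam.1))

end Schur

section Center

variable (K : Type*) [Field K] {n : ℕ}

/-- `S_λ = (-1)^{n(n-1)/2} y_1^{λ_1+n-1} y_2^{λ_2+n-2} ⋯ y_n^{λ_n} ψ_{w_{0,n}}` in `H_n`. -/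
def S (lam : Partitions n) : Alg K n :=
  (-1) ^ (n * (n - 1) / 2) * (List.ofFn fun i => y K i ^ addDelta lam.1 i).prod *
    psiPerm K (longest n)

/-- `z` is a symmetric polynomial in `y_1, …, y_n` with `g ≡ z mod J_n`. -/
def IsSymmPart (g z : Alg K n) : Prop :=
  (∃ p : MvPolynomial (Fin n) K, p.IsSymmetric ∧ z = evalAt (y K) p) ∧ g - z ∈ J K n

/-- `z(λ)`: the symmetric polynomial in `y_1, …, y_n` with `S_λ ≡ z(λ) mod J_n`. -/
def zPart (lam : Partitions n) : Alg K n := Classical.epsilon (IsSymmPart K (S K lam))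

/-- `z_λ = π_ℓ(z(λ))` in `H_{ℓ,n}`. -/
def zCyc (ℓ : ℕ) [NeZero n] (lam : Partitions n) : CycAlg K n ℓ := proj K n ℓ (zPart K lam)

end Center

end NilHecke

end

/-!
The nilHecke algebra acts on `K[x_1, …, x_n]`: `y_k` acts by multiplication with `x_k`, and `ψ_r`
by the divided difference `ddiff r : f ↦ (f - s_r f) / (x_{r+1} - x_r)` (`rep`). The relations are
stable under the anti-involution `anti` fixing the generators, so the polynomials are also a right
module, and this right module is `H_n / J_n`: moving the `ψ_r` to the left gives
`f(y) h ≡ (rep (anti h) f)(y)` modulo `J_n` (`pol_mul_sub_mem_J`), and a polynomial in the `y_k`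
lying in `J_n` is zero (`eq_zero_of_pol_mem_J`). Divided differences are self-adjoint for the form
`(f, g) ↦ A(f g)` with `A = ∑_w sgn(w) w`. As `ψ_{w_0}` sends `x^δ` to `(-1)^{n(n-1)/2}`, it follows
that `a_δ · rep (anti ψ_{w_0}) f = (-1)^{n(n-1)/2} A(f)` (`delta_mul_rep_anti`). For `f = x^{μ+δ}`
this says that `S_μ ≡ s_μ(y)` modulo `J_n`, hence `z(μ) = s_μ(y)` for all `μ`. That the products
along all reduced words of `w_0` agree is shown through canonical words, concatenations of
ascending segments, onto which every word can be rewritten (`exists_canon`).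

The center of `H_{ℓ,n}` is described by means of the element `ψ = ψ_{w_0}`.
* The two-sided ideal generated by `ψ` is `H_n` (`one_mem_of_psiPerm_longest_mem`): multiplying with
  suitable `y_k` from both sides strips off the letters of `ψ` one by one. So an element that is
  central modulo a two-sided ideal `I` lies in `I` if its product with `ψ` does.
* `ψ H_n ψ` consists of multiples of `ψ` by symmetric polynomials, and `ψ y^δ ψ = ± ψ`. If `x` is
  central modulo `(y_1^ℓ)`, then `x ψ = ± x ψ y^δ ψ ≡ ± ψ x y^δ ψ` is such a multiple, hence `x` is
  congruent to a symmetric polynomial (`exists_symmetric_of_mem_center`), that is, to a combination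
  of Schur polynomials.
* If `μ_1 > ℓ - n`, then `y_1^ℓ` divides `y^{μ+δ}`, and `± ψ s_μ(y) = ψ y^{μ+δ} ψ` shows that
  `s_μ(y)` vanishes in `H_{ℓ,n}` (`pol_schur_mem_cycIdeal`). The remaining `μ` are the `ρ(λ)`.
* For `h` in the ideal generated by `y_1^ℓ`, adjointness puts `A(f · rep h g)` into `A(x_1^ℓ K[x])`,
  where every monomial has an exponent `≥ ℓ` (`coeff_alt_of_mem_cycIdeal`). Since `A(x^δ s_μ)` is
  `a_{μ+δ}`, which has leading monomial `x^{μ+δ}`, the `s_{ρ(λ)}(y)` are linearly independent in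
  `H_{ℓ,n}`.
-/

noncomputable section

namespace NilHecke

/-! ### Reduced words in the symmetric group and the nilCoxeter relations -/

section Words

variable {n : ℕ}

/-- The word `a, a + 1, …, a + d - 1`. -/
def seg (a : ℕ) : (d : ℕ) → a + d ≤ n - 1 → List (Fin (n - 1))
  | 0, _ => []
  | d + 1, h => ⟨a, by omega⟩ :: seg (a + 1) d (by omega)

theorem seg_length (a d : ℕ) (h : a + d ≤ n - 1) : (seg a d h).length = d := by
  induction d generalizing a with
  | zero => rfl
  | succ d ih => simp [seg, ih]

section Monoid

variable {M : Type*} [Monoid M] {g : Fin (n - 1) → M}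

theorem seg_prod_comm (x : M) (a d : ℕ) (h : a + d ≤ n - 1)
    (hx : ∀ k : Fin (n - 1), a ≤ k.val → x * g k = g k * x) :
    x * ((seg a d h).map g).prod = ((seg a d h).map g).prod * x := by
  induction d generalizing a with
  | zero => simp [seg]
  | succ d ih =>
    have h1 := ih (a + 1) (by omega) fun k hk => hx k (by omega)
    rw [seg, List.map_cons, List.prod_cons, ← mul_assoc, hx _ le_rfl, mul_assoc, h1, mul_assoc]

/-- In a monoid with elements satisfying the braid relations, moving a letter from the left to the
right of an ascending segment lowers it by one. -/
theorem seg_prod_braid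
    (hcomm : ∀ r k : Fin (n - 1), k.val + 1 < r.val → g r * g k = g k * g r)
    (hbraid : ∀ r r' : Fin (n - 1), r'.val = r.val + 1 → g r * g r' * g r = g r' * g r * g r')
    (a d : ℕ) (h : a + d ≤ n - 1) (r r' : Fin (n - 1)) (hr : r'.val = r.val + 1)
    (har : a ≤ r.val) (hrd : r'.val < a + d) :
    g r' * ((seg a d h).map g).prod = ((seg a d h).map g).prod * g r := by
  induction d generalizing a with
  | zero => omega
  | succ d ih =>
    rw [seg, List.map_cons, List.prod_cons]
    rcases har.eq_or_lt with har | har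
    · obtain ⟨d, rfl⟩ : ∃ e, d = e + 1 := ⟨d - 1, by omega⟩
      have e1 : (⟨a, by omega⟩ : Fin (n - 1)) = r := Fin.ext har
      have e2 : (⟨a + 1, by omega⟩ : Fin (n - 1)) = r' := Fin.ext (by simp; omega)
      have h1 := seg_prod_comm (g := g) (g r) (a + 1 + 1) d (by omega)
        fun k hk => (hcomm k r (by omega)).symm
      rw [seg, List.map_cons, List.prod_cons, e1, e2, ← mul_assoc, ← mul_assoc, ← hbraid r r' hr,
        mul_assoc, h1]
      simp only [mul_assoc]
    · rw [← mul_assoc, hcomm r' ⟨a, by omega⟩ (by simp; omega), mul_assoc,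
        ih (a + 1) (by omega) (by omega) (by omega), mul_assoc]

end Monoid

theorem simpleRefl_mul_self (r : Fin (n - 1)) : simpleRefl r * simpleRefl r = 1 :=
  Equiv.swap_mul_self _ _

theorem simpleRefl_comm (r k : Fin (n - 1)) (h : k.val + 1 < r.val) :
    simpleRefl r * simpleRefl k = simpleRefl k * simpleRefl r := by
  refine (Equiv.Perm.Disjoint.commute ?_).eq
  rw [Equiv.Perm.disjoint_iff_disjoint_support]
  simp only [simpleRefl]
  rw [Equiv.Perm.support_swap, Equiv.Perm.support_swap]
  · simp [lo, hi]; omega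
  · simp [lo, hi]
  · simp [lo, hi]

theorem simpleRefl_braid (r r' : Fin (n - 1)) (h : r'.val = r.val + 1) :
    simpleRefl r * simpleRefl r' * simpleRefl r = simpleRefl r' * simpleRefl r * simpleRefl r' := by
  have e : lo r' = hi r := Fin.ext h
  have h1 : lo r ≠ hi r := by simp [lo, hi]
  have h2 : lo r ≠ hi r' := by simp [lo, hi]; omega
  have h3 : hi r ≠ hi r' := by simp [hi]; omega
  have e1 := Equiv.swap_mul_swap_mul_swap h3.symm h2.symm
  have e2 := Equiv.swap_mul_swap_mul_swap h1 h2
  rw [Equiv.swap_comm (hi r) (lo r), Equiv.swap_comm (hi r') (hi r)] at e1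
  simp only [simpleRefl, e]
  rw [e1, e2, Equiv.swap_comm]

theorem simpleRefl_apply (r : Fin (n - 1)) (i : Fin n) :
    (simpleRefl r i).val =
      if i.val = r.val then r.val + 1 else if i.val = r.val + 1 then r.val else i.val := by
  rw [simpleRefl, Equiv.swap_apply_def]
  split_ifs with h1 h2 h3 h4 h5 h6 <;> simp_all [lo, hi, Fin.ext_iff]

theorem wordPerm_append (l l' : List (Fin (n - 1))) :
    wordPerm (l ++ l') = wordPerm l * wordPerm l' := by
  simp [wordPerm]

theorem wordPerm_cons (r : Fin (n - 1)) (l : List (Fin (n - 1))) :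
    wordPerm (r :: l) = simpleRefl r * wordPerm l := by
  simp [wordPerm]

/-- The segment `a, …, a + d - 1` is a word of the cycle `a → a + 1 → ⋯ → a + d → a`. -/
theorem wordPerm_seg_apply (a d : ℕ) (h : a + d ≤ n - 1) (i : Fin n) :
    (wordPerm (seg a d h) i).val =
      if i.val = a + d then a else if a ≤ i.val ∧ i.val < a + d then i.val + 1 else i.val := by
  induction d generalizing a with
  | zero =>
    simp only [seg, wordPerm, List.map_nil, List.prod_nil, Equiv.Perm.one_apply]
    split_ifs <;> omega
  | succ d ih =>
    rw [seg, wordPerm_cons, Equiv.Perm.mul_apply, simpleRefl_apply, ih]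
    simp only
    split_ifs <;> omega

/-- The canonical reduced words in the letters `0, …, m - 1`: concatenations
`(a_m, …, m - 1), (a_{m-1}, …, m - 2), …` of segments. -/
inductive Canon : ℕ → List (Fin (n - 1)) → Prop
  | zero : Canon 0 []
  | step (m a d : ℕ) (h : a + d = m + 1) (hm : m + 1 ≤ n - 1) (W : List (Fin (n - 1)))
      (hW : Canon m W) : Canon (m + 1) (seg a d (h ▸ hm) ++ W)

theorem Canon.perm_apply {m : ℕ} {W : List (Fin (n - 1))} (h : Canon m W) (i : Fin n)
    (hi : m < i.val) : wordPerm W i = i := by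
  induction h with
  | zero => simp [wordPerm]
  | step m a d h hm W hW ih =>
    refine Fin.ext ?_
    rw [wordPerm_append, Equiv.Perm.mul_apply, ih (by omega), wordPerm_seg_apply]
    split_ifs <;> omega

/-- A canonical word is determined by its permutation. -/
theorem Canon.unique {m : ℕ} {W W' : List (Fin (n - 1))} (h : Canon m W) (h' : Canon m W')
    (e : wordPerm W = wordPerm W') : W = W' := by
  induction h generalizing W' with
  | zero => cases h'; rfl
  | step m a d h hm W hW ih =>
    cases h' with
    | step _ a' d' h2 _ V hV =>
      rw [wordPerm_append, wordPerm_append] at e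
      -- the image of `m + 1` is the first letter of the leading segment
      have e1 := congrArg (fun w => (w ⟨m + 1, by omega⟩).val) e
      simp only [Equiv.Perm.mul_apply] at e1
      rw [hW.perm_apply _ (by simp), hV.perm_apply _ (by simp), wordPerm_seg_apply,
        wordPerm_seg_apply, if_pos h.symm, if_pos h2.symm] at e1
      obtain rfl := e1
      obtain rfl : d = d' := by omega
      rw [ih hV (mul_left_cancel e)]

variable (n) in
/-- The longest canonical word in the letters `0, …, m - 1`. -/
def longWord : (m : ℕ) → m ≤ n - 1 → List (Fin (n - 1))
  | 0, _ => []
  | m + 1, h => seg 0 (m + 1) (by omega) ++ longWord m (by omega)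

theorem canon_longWord (m : ℕ) (h : m ≤ n - 1) : Canon m (longWord n m h) := by
  induction m with
  | zero => exact .zero
  | succ m ih => exact .step m 0 (m + 1) (by omega) h _ (ih (by omega))

theorem longWord_lt (m : ℕ) (h : m ≤ n - 1) : ∀ r ∈ longWord n m h, r.val < m := by
  have hseg : ∀ (d a : ℕ) (h : a + d ≤ n - 1), ∀ r ∈ seg a d h, r.val < a + d := by
    intro d
    induction d with
    | zero => simp [seg]
    | succ d ih =>
      intro a h r hr
      rw [seg, List.mem_cons] at hr
      rcases hr with rfl | hr
      · simp
      · have := ih _ _ r hr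
        omega
  induction m with
  | zero => simp [longWord]
  | succ m ih =>
    intro r hr
    rw [longWord, List.mem_append] at hr
    rcases hr with hr | hr
    · simpa using hseg _ _ _ r hr
    · exact (ih _ r hr).trans (Nat.lt_succ_self m)

theorem Canon.length_le {m : ℕ} {W : List (Fin (n - 1))} (hW : Canon m W) (h : m ≤ n - 1) :
    W.length ≤ (longWord n m h).length := by
  induction hW with
  | zero => simp
  | step m a d h1 hm W hW ih =>
    have := ih (by omega)
    simp only [longWord, List.length_append, seg_length]
    omega

theorem longWord_length (m : ℕ) (h : m ≤ n - 1) :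
    (longWord n m h).length = (m + 1) * m / 2 := by
  have h2 : (longWord n m h).length * 2 = (m + 1) * m := by
    induction m with
    | zero => simp [longWord]
    | succ m ih =>
      have := ih (by omega)
      simp only [longWord, List.length_append, seg_length]
      linarith
  omega

theorem wordPerm_longWord_apply (m : ℕ) (h : m ≤ n - 1) (i : Fin n) (hi : i.val ≤ m) :
    (wordPerm (longWord n m h) i).val = m - i.val := by
  induction m with
  | zero => simp [longWord, wordPerm]; omega
  | succ m ih =>
    rw [longWord, wordPerm_append, Equiv.Perm.mul_apply, wordPerm_seg_apply]
    rcases hi.eq_or_lt with hi | hi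
    · rw [(canon_longWord m (by omega)).perm_apply i (by omega)]
      split_ifs <;> omega
    · rw [ih (by omega) (by omega)]
      split_ifs <;> omega

theorem wordPerm_longWord : wordPerm (longWord n (n - 1) le_rfl) = longest n := by
  ext i
  rw [wordPerm_longWord_apply _ _ i (by omega)]
  simp [longest]
  omega

section NilCoxeter

variable {M : Type*} [MonoidWithZero M] {g : Fin (n - 1) → M}

/-- Multiplying a canonical word by a letter gives a canonical word if the length goes up, and
zero if it goes down. -/
theorem Canon.exists_cons (hsq : ∀ r, g r * g r = 0)
    (hcomm : ∀ r k : Fin (n - 1), k.val + 1 < r.val → g r * g k = g k * g r)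
    (hbraid : ∀ r r' : Fin (n - 1), r'.val = r.val + 1 → g r * g r' * g r = g r' * g r * g r')
    {m : ℕ} {W : List (Fin (n - 1))} (hW : Canon m W) (r : Fin (n - 1)) (hr : r.val < m) :
    ∃ W', Canon m W' ∧ wordPerm W' = simpleRefl r * wordPerm W ∧
      ((W'.length = W.length + 1 ∧ (W'.map g).prod = g r * (W.map g).prod) ∨
        (W.length = W'.length + 1 ∧ g r * (W.map g).prod = 0)) := by
  induction hW generalizing r with
  | zero => omega
  | step m a d h hm W hW ih =>
    -- the letter `r` passes the leading segment and becomes the letter `k`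
    have key : ∀ k : Fin (n - 1), k.val < m →
        (simpleRefl r * wordPerm (seg a d (h ▸ hm)) =
          wordPerm (seg a d (h ▸ hm)) * simpleRefl k) →
        (g r * ((seg a d (h ▸ hm)).map g).prod = ((seg a d (h ▸ hm)).map g).prod * g k) →
        ∃ W', Canon (m + 1) W' ∧
          wordPerm W' = simpleRefl r * wordPerm (seg a d (h ▸ hm) ++ W) ∧
          ((W'.length = (seg a d (h ▸ hm) ++ W).length + 1 ∧
            (W'.map g).prod = g r * ((seg a d (h ▸ hm) ++ W).map g).prod) ∨
          ((seg a d (h ▸ hm) ++ W).length = W'.length + 1 ∧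
            g r * ((seg a d (h ▸ hm) ++ W).map g).prod = 0)) := by
      intro k hk e1 e2
      obtain ⟨V, hV, hp, hl⟩ := ih k hk
      refine ⟨_, .step m a d h hm V hV, ?_, ?_⟩
      · rw [wordPerm_append, wordPerm_append, hp, ← mul_assoc, ← mul_assoc, e1]
      · simp only [List.length_append, List.map_append, List.prod_append, ← mul_assoc, e2]
        simp only [mul_assoc]
        rcases hl with ⟨hl, hl'⟩ | ⟨hl, hl'⟩
        · exact .inl ⟨by omega, by rw [hl']⟩
        · exact .inr ⟨by omega, by rw [hl', mul_zero]⟩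
    rcases lt_trichotomy (r.val + 1) a with hra | hra | hra
    · exact key r (by omega)
        (seg_prod_comm _ _ _ _ fun k hk => (simpleRefl_comm k r (by omega)).symm)
        (seg_prod_comm _ _ _ _ fun k hk => (hcomm k r (by omega)).symm)
    · subst hra
      refine ⟨_, .step m r.val (d + 1) (by omega) hm W hW, ?_, .inl ⟨?_, ?_⟩⟩
      · simp [seg, wordPerm_append, wordPerm_cons]
      · simp [seg_length]; omega
      · simp [seg]
    · rcases (Nat.lt_succ_iff.1 hra).eq_or_lt with hra | hra
      · subst hra
        obtain ⟨d, rfl⟩ : ∃ e, d = e + 1 := ⟨d - 1, by omega⟩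
        refine ⟨_, .step m (r.val + 1) d (by omega) hm W hW, ?_, .inr ⟨?_, ?_⟩⟩
        · simp only [seg, wordPerm_append, wordPerm_cons, ← mul_assoc, simpleRefl_mul_self, one_mul]
        · simp [seg_length]; omega
        · simp [seg, ← mul_assoc, hsq]
      · exact key ⟨r.val - 1, by omega⟩ (by simp; omega)
          (seg_prod_braid simpleRefl_comm simpleRefl_braid _ _ _ _ _ (by simp; omega)
            (by simp; omega) (by omega))
          (seg_prod_braid hcomm hbraid _ _ _ _ _ (by simp; omega) (by simp; omega) (by omega))

/-- Every word has a canonical word of the same permutation. It is not longer; if it is shorter,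
then the product along the given word is zero, otherwise the two products agree. -/
theorem exists_canon (hsq : ∀ r, g r * g r = 0)
    (hcomm : ∀ r k : Fin (n - 1), k.val + 1 < r.val → g r * g k = g k * g r)
    (hbraid : ∀ r r' : Fin (n - 1), r'.val = r.val + 1 → g r * g r' * g r = g r' * g r * g r')
    {m : ℕ} (hm : m ≤ n - 1) (l : List (Fin (n - 1))) (hl : ∀ r ∈ l, r.val < m) :
    ∃ W, Canon m W ∧ wordPerm W = wordPerm l ∧
      ((W.length = l.length ∧ (W.map g).prod = (l.map g).prod) ∨
        (W.length < l.length ∧ (l.map g).prod = 0)) := by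
  induction l with
  | nil =>
    -- the empty word is canonical, with all segments empty
    have hnil : ∀ m ≤ n - 1, Canon (n := n) m [] := by
      intro m
      induction m with
      | zero => exact fun _ => .zero
      | succ m ih => exact fun h => .step m (m + 1) 0 (by omega) h [] (ih (by omega))
    exact ⟨[], hnil m hm, rfl, .inl ⟨rfl, rfl⟩⟩
  | cons r l ih =>
    obtain ⟨W, hW, hp, h⟩ := ih fun k hk => hl k (List.mem_cons_of_mem _ hk)
    obtain ⟨W', hW', hp', h'⟩ := hW.exists_cons hsq hcomm hbraid r (hl r List.mem_cons_self)
    refine ⟨W', hW', by rw [hp', hp, wordPerm_cons], ?_⟩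
    simp only [List.length_cons, List.map_cons, List.prod_cons]
    rcases h with ⟨h1, h2⟩ | ⟨h1, h2⟩
    · rw [← h2]
      rcases h' with ⟨h3, h4⟩ | ⟨h3, h4⟩
      · exact .inl ⟨by omega, h4⟩
      · exact .inr ⟨by omega, h4⟩
    · refine .inr ⟨?_, by rw [h2, mul_zero]⟩
      rcases h' with ⟨h3, h4⟩ | ⟨h3, h4⟩ <;> omega

theorem prod_eq_zero_of_length_lt (hsq : ∀ r, g r * g r = 0)
    (hcomm : ∀ r k : Fin (n - 1), k.val + 1 < r.val → g r * g k = g k * g r)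
    (hbraid : ∀ r r' : Fin (n - 1), r'.val = r.val + 1 → g r * g r' * g r = g r' * g r * g r')
    {m : ℕ} (hm : m ≤ n - 1) (l : List (Fin (n - 1))) (hl : ∀ r ∈ l, r.val < m)
    (hlen : (longWord n m hm).length < l.length) : (l.map g).prod = 0 := by
  obtain ⟨W, hW, -, h | h⟩ := exists_canon hsq hcomm hbraid hm l hl
  · have := hW.length_le hm
    omega
  · exact h.2

/-- All reduced words of the longest permutation have the same product. -/
theorem prod_reducedExpr_longest (hsq : ∀ r, g r * g r = 0)
    (hcomm : ∀ r k : Fin (n - 1), k.val + 1 < r.val → g r * g k = g k * g r)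
    (hbraid : ∀ r r' : Fin (n - 1), r'.val = r.val + 1 → g r * g r' * g r = g r' * g r * g r') :
    ((reducedExpr (longest n)).map g).prod = ((longWord n (n - 1) le_rfl).map g).prod := by
  obtain ⟨h1, h2⟩ := Classical.choose_spec (exists_isReducedExpr (longest n))
  change wordPerm (reducedExpr (longest n)) = _ at h1
  obtain ⟨W, hW, hp, h⟩ := exists_canon hsq hcomm hbraid le_rfl (reducedExpr (longest n))
    fun r _ => r.isLt
  have hlen := h2 W (hp.trans h1)
  change (reducedExpr (longest n)).length ≤ _ at hlen
  rcases h with h | h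
  · rw [← h.2, hW.unique (canon_longWord _ _) ((hp.trans h1).trans wordPerm_longWord.symm)]
  · omega

end NilCoxeter

end Words

/-! ### Divided difference operators -/

section DividedDifference

open MvPolynomial

variable {K : Type*} [Field K] {n : ℕ}

theorem lo_ne_hi (r : Fin (n - 1)) : lo r ≠ hi r := by simp [lo, hi]

variable (K) in
/-- The difference `x_{r+1} - x_r`. -/
def xdiff (r : Fin (n - 1)) : MvPolynomial (Fin n) K := X (hi r) - X (lo r)

theorem xdiff_ne_zero (r : Fin (n - 1)) : xdiff K r ≠ 0 :=
  sub_ne_zero.2 fun h => lo_ne_hi r (X_injective h).symm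

variable (K) in
/-- The action of the simple transposition `s_r` on polynomials. -/
abbrev swp (r : Fin (n - 1)) : MvPolynomial (Fin n) K →ₐ[K] MvPolynomial (Fin n) K :=
  rename (simpleRefl r)

@[simp] theorem swp_X_lo (r : Fin (n - 1)) : swp K r (X (lo r)) = X (hi r) := by
  simp [simpleRefl]

@[simp] theorem swp_X_hi (r : Fin (n - 1)) : swp K r (X (hi r)) = X (lo r) := by
  simp [simpleRefl]

theorem swp_X_of_ne (r : Fin (n - 1)) (k : Fin n) (h₁ : k ≠ lo r) (h₂ : k ≠ hi r) :
    swp K r (X k) = X k := by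
  simp [simpleRefl, Equiv.swap_apply_of_ne_of_ne h₁ h₂]

@[simp] theorem swp_swp (r : Fin (n - 1)) (f : MvPolynomial (Fin n) K) :
    swp K r (swp K r f) = f := by
  rw [swp, rename_rename, ← Equiv.Perm.coe_mul, simpleRefl_mul_self]
  simp

@[simp] theorem swp_xdiff (r : Fin (n - 1)) : swp K r (xdiff K r) = -xdiff K r := by
  simp only [xdiff, map_sub, swp_X_lo, swp_X_hi]
  ring

theorem xdiff_dvd (r : Fin (n - 1)) (f : MvPolynomial (Fin n) K) :
    xdiff K r ∣ f - swp K r f := by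
  induction f using MvPolynomial.induction_on with
  | C a => simp
  | add f g hf hg =>
    rw [map_add, add_sub_add_comm]
    exact dvd_add hf hg
  | mul_X f k hf =>
    have hk : xdiff K r ∣ X k - swp K r (X k) := by
      by_cases h₁ : k = lo r
      · subst h₁
        exact ⟨-1, by rw [swp_X_lo, xdiff]; ring⟩
      by_cases h₂ : k = hi r
      · subst h₂
        exact ⟨1, by rw [swp_X_hi, xdiff]; ring⟩
      rw [swp_X_of_ne r k h₁ h₂, sub_self]
      exact dvd_zero _
    have e : f * X k - swp K r (f * X k) =
        (f - swp K r f) * X k + swp K r f * (X k - swp K r (X k)) := by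
      rw [map_mul]
      ring
    rw [e]
    exact dvd_add (hf.mul_right _) (hk.mul_left _)

/-- The quotient defining the divided difference operator `ddiff`. -/
def ddiffFun (r : Fin (n - 1)) (f : MvPolynomial (Fin n) K) : MvPolynomial (Fin n) K :=
  Classical.choose (xdiff_dvd r f)

theorem xdiff_mul_ddiffFun (r : Fin (n - 1)) (f : MvPolynomial (Fin n) K) :
    xdiff K r * ddiffFun r f = f - swp K r f :=
  (Classical.choose_spec (xdiff_dvd r f)).symm

variable (K) in
/-- The divided difference operator `f ↦ (f - s_r f) / (x_{r+1} - x_r)`. The sign is opposite to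
the usual one, so that these operators and the multiplications by the variables satisfy the
relations of the nilHecke algebra. -/
def ddiff (r : Fin (n - 1)) : MvPolynomial (Fin n) K →ₗ[K] MvPolynomial (Fin n) K where
  toFun := ddiffFun r
  map_add' f g := mul_left_cancel₀ (xdiff_ne_zero r) <| by
    rw [mul_add]
    simp only [xdiff_mul_ddiffFun, map_add]
    ring
  map_smul' c f := mul_left_cancel₀ (xdiff_ne_zero r) <| by
    rw [RingHom.id_apply, mul_smul_comm]
    simp only [xdiff_mul_ddiffFun, map_smul, smul_sub]

theorem xdiff_mul_ddiff (r : Fin (n - 1)) (f : MvPolynomial (Fin n) K) :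
    xdiff K r * ddiff K r f = f - swp K r f :=
  xdiff_mul_ddiffFun r f

theorem ddiff_eq_of_xdiff_mul {r : Fin (n - 1)} {f g : MvPolynomial (Fin n) K}
    (h : xdiff K r * g = f - swp K r f) : ddiff K r f = g :=
  mul_left_cancel₀ (xdiff_ne_zero r) ((xdiff_mul_ddiff r f).trans h.symm)

theorem ddiff_eq_zero_iff {r : Fin (n - 1)} {f : MvPolynomial (Fin n) K} :
    ddiff K r f = 0 ↔ swp K r f = f := by
  constructor
  · intro h
    have := xdiff_mul_ddiff r f
    rw [h, mul_zero] at this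
    exact (sub_eq_zero.1 this.symm).symm
  · intro h
    exact ddiff_eq_of_xdiff_mul (by rw [h, mul_zero, sub_self])

@[simp] theorem swp_ddiff (r : Fin (n - 1)) (f : MvPolynomial (Fin n) K) :
    swp K r (ddiff K r f) = ddiff K r f := by
  refine mul_left_cancel₀ (xdiff_ne_zero r) ?_
  have h := congrArg (swp K r) (xdiff_mul_ddiff r f)
  rw [map_mul, swp_xdiff, map_sub, swp_swp] at h
  linear_combination -h - xdiff_mul_ddiff r f

/-- The twisted Leibniz rule. -/
theorem ddiff_mul (r : Fin (n - 1)) (f g : MvPolynomial (Fin n) K) :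
    ddiff K r (f * g) = swp K r f * ddiff K r g + ddiff K r f * g := by
  refine ddiff_eq_of_xdiff_mul ?_
  rw [map_mul]
  linear_combination swp K r f * xdiff_mul_ddiff r g + g * xdiff_mul_ddiff r f

theorem ddiff_X_hi (r : Fin (n - 1)) : ddiff K r (X (hi r)) = 1 :=
  ddiff_eq_of_xdiff_mul (by rw [swp_X_hi, xdiff, mul_one])

theorem ddiff_X_lo (r : Fin (n - 1)) : ddiff K r (X (lo r)) = -1 :=
  ddiff_eq_of_xdiff_mul (by rw [swp_X_lo, xdiff]; ring)

theorem ddiff_X_of_ne (r : Fin (n - 1)) (k : Fin n) (h₁ : k ≠ lo r) (h₂ : k ≠ hi r) :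
    ddiff K r (X k) = 0 :=
  ddiff_eq_zero_iff.2 (swp_X_of_ne r k h₁ h₂)

theorem ddiff_ddiff (r : Fin (n - 1)) (f : MvPolynomial (Fin n) K) :
    ddiff K r (ddiff K r f) = 0 :=
  ddiff_eq_zero_iff.2 (swp_ddiff r f)

theorem swp_comm (r k : Fin (n - 1)) (h : k.val + 1 < r.val) (f : MvPolynomial (Fin n) K) :
    swp K r (swp K k f) = swp K k (swp K r f) := by
  simp only [swp, rename_rename, ← Equiv.Perm.coe_mul, simpleRefl_comm r k h]

theorem swp_braid (r r' : Fin (n - 1)) (h : r'.val = r.val + 1) (f : MvPolynomial (Fin n) K) :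
    swp K r (swp K r' (swp K r f)) = swp K r' (swp K r (swp K r' f)) := by
  simp only [swp, rename_rename, ← Equiv.Perm.coe_mul, ← mul_assoc, simpleRefl_braid r r' h]

theorem ddiff_comm (r k : Fin (n - 1)) (h : k.val + 1 < r.val) (f : MvPolynomial (Fin n) K) :
    ddiff K r (ddiff K k f) = ddiff K k (ddiff K r f) := by
  have h1 : swp K r (xdiff K k) = xdiff K k := by
    simp only [xdiff, map_sub]
    rw [swp_X_of_ne, swp_X_of_ne] <;> simp [lo, hi] <;> omega
  have h2 : swp K k (xdiff K r) = xdiff K r := by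
    simp only [xdiff, map_sub]
    rw [swp_X_of_ne, swp_X_of_ne] <;> simp [lo, hi] <;> omega
  refine mul_left_cancel₀ (mul_ne_zero (xdiff_ne_zero r) (xdiff_ne_zero k)) ?_
  have e1 := congrArg (swp K r) (xdiff_mul_ddiff k f)
  have e2 := congrArg (swp K k) (xdiff_mul_ddiff r f)
  rw [map_mul, h1, map_sub] at e1
  rw [map_mul, h2, map_sub] at e2
  linear_combination xdiff K k * xdiff_mul_ddiff r (ddiff K k f) + xdiff_mul_ddiff k f - e1
    - xdiff K r * xdiff_mul_ddiff k (ddiff K r f) - xdiff_mul_ddiff r f + e2 + swp_comm r k h f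

/-- Both sides of the braid relation are the alternating sum over the group generated by `s_r` and
`s_{r+1}`, divided by the Vandermonde determinant of three variables. -/
theorem ddiff_braid (r r' : Fin (n - 1)) (h : r'.val = r.val + 1) (f : MvPolynomial (Fin n) K) :
    ddiff K r (ddiff K r' (ddiff K r f)) = ddiff K r' (ddiff K r (ddiff K r' f)) := by
  have e : lo r' = hi r := Fin.ext h
  have h2 : lo r ≠ hi r' := by simp [lo, hi]; omega
  have h3 : hi r ≠ hi r' := by simp [hi]; omega
  have s1 : swp K r (X (hi r')) = X (hi r') := swp_X_of_ne r _ h2.symm h3.symm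
  have s2 : swp K r' (X (lo r)) = X (lo r) := swp_X_of_ne r' _ (e ▸ lo_ne_hi r) h2
  have s3 : swp K r' (X (hi r)) = X (hi r') := e ▸ swp_X_lo r'
  have s4 : swp K r' (X (hi r')) = X (hi r) := e ▸ swp_X_hi r'
  have hne : (X (hi r') - X (lo r) : MvPolynomial (Fin n) K) ≠ 0 :=
    sub_ne_zero.2 fun h => h2 (X_injective h).symm
  refine mul_left_cancel₀ (mul_ne_zero (mul_ne_zero (xdiff_ne_zero r) (xdiff_ne_zero r')) hne) ?_
  set u := ddiff K r f with hu
  set v := ddiff K r' f with hv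
  -- the left-hand side
  have a1 := xdiff_mul_ddiff r (ddiff K r' u)
  have a2 := xdiff_mul_ddiff r' u
  have a3 := xdiff_mul_ddiff r f
  have a4 := congrArg (swp K r) a2
  have a5 := congrArg (swp K r') a3
  have a6 := congrArg (swp K r) a5
  have a7 : swp K r u = u := swp_ddiff r f
  -- the right-hand side
  have b1 := xdiff_mul_ddiff r' (ddiff K r v)
  have b2 := xdiff_mul_ddiff r v
  have b3 := xdiff_mul_ddiff r' f
  have b4 := congrArg (swp K r') b2
  have b5 := congrArg (swp K r) b3
  have b6 := congrArg (swp K r') b5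
  have b7 : swp K r' v = v := swp_ddiff r' f
  rw [← hu] at a3 a5 a6
  rw [← hv] at b3 b5 b6
  simp only [xdiff, e, map_mul, map_sub, swp_X_lo, swp_X_hi, s1, s2, s3, s4, a7, b7]
    at a1 a2 a3 a4 a5 a6 b1 b2 b3 b4 b5 b6 ⊢
  linear_combination (X (hi r') - X (hi r)) * (X (hi r') - X (lo r)) * a1
    + (X (hi r') - X (lo r)) * a2 - (X (hi r') - X (hi r)) * a4 + a3 - a5 + a6
    - (X (hi r) - X (lo r)) * (X (hi r') - X (lo r)) * b1
    - (X (hi r') - X (lo r)) * b2 + (X (hi r) - X (lo r)) * b4 - b3 + b5 - b6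
    - swp_braid r r' h f

end DividedDifference

/-! ### Alternating sums and Schur polynomials -/

section Alternating

open MvPolynomial

variable {K : Type*} [Field K] {n : ℕ}

variable (K) in
/-- The monomial `x_1^{c_1} ⋯ x_n^{c_n}`. -/
def mono (c : Fin n → ℕ) : MvPolynomial (Fin n) K := ∏ i, X i ^ c i

theorem mono_eq_monomial (c : Fin n → ℕ) :
    mono K c = monomial (Finsupp.equivFunOnFinite.symm c) 1 := by
  rw [monomial_eq, map_one, one_mul, Finsupp.prod_fintype _ _ fun i => pow_zero _]
  rfl

theorem mono_add (c d : Fin n → ℕ) : mono K (c + d) = mono K c * mono K d := by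
  simp [mono, pow_add, Finset.prod_mul_distrib]

theorem coeff_mono (c d : Fin n → ℕ) :
    coeff (Finsupp.equivFunOnFinite.symm d) (mono K c) = if c = d then 1 else 0 := by
  rw [mono_eq_monomial, coeff_monomial]
  simp

theorem rename_mono (w : Equiv.Perm (Fin n)) (c : Fin n → ℕ) :
    rename w (mono K c) = mono K (c ∘ w.symm) := by
  simp only [mono, map_prod, map_pow, rename_X, Function.comp_apply]
  exact Fintype.prod_equiv w _ _ fun i => by simp

/-- Monomials span, as an induction principle. -/
theorem mono_induction {p : MvPolynomial (Fin n) K → Prop} (f : MvPolynomial (Fin n) K)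
    (hmono : ∀ c, p (mono K c)) (hadd : ∀ f g, p f → p g → p (f + g))
    (hsmul : ∀ (a : K) f, p f → p (a • f)) : p f := by
  induction f using MvPolynomial.induction_on' with
  | monomial u a =>
    have : monomial u a = a • mono K u := by
      rw [mono_eq_monomial, smul_monomial, smul_eq_mul, mul_one]
      exact congrArg (fun v => monomial v a) (Finsupp.equivFunOnFinite.symm_apply_apply u).symm
    rw [this]
    exact hsmul a _ (hmono u)
  | add f g hf hg => exact hadd f g hf hg

variable (K n) in
/-- The alternating sum `f ↦ ∑_w sgn(w) w(f)`. -/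
def alt : MvPolynomial (Fin n) K →ₗ[K] MvPolynomial (Fin n) K where
  toFun f := ∑ w : Equiv.Perm (Fin n), Equiv.Perm.sign w • rename w f
  map_add' f g := by simp [Finset.sum_add_distrib]
  map_smul' a f := by
    simp only [map_smul, RingHom.id_apply, Finset.smul_sum]
    exact Finset.sum_congr rfl fun w _ => smul_comm _ _ _

theorem alt_apply (f : MvPolynomial (Fin n) K) :
    alt K n f = ∑ w : Equiv.Perm (Fin n), Equiv.Perm.sign w • rename w f := rfl

theorem alt_mono (c : Fin n → ℕ) : alt K n (mono K c) = alternant K c := by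
  simp [alt_apply, alternant, mono]

theorem sign_simpleRefl (r : Fin (n - 1)) : Equiv.Perm.sign (simpleRefl r) = -1 :=
  Equiv.Perm.sign_swap (lo_ne_hi r)

/-- The summands of `w` and `w s_r` cancel. -/
theorem alt_eq_zero {r : Fin (n - 1)} {f : MvPolynomial (Fin n) K} (h : swp K r f = f) :
    alt K n f = 0 := by
  rw [alt_apply]
  refine Finset.sum_involution (fun w _ => w * simpleRefl r) (fun w _ => ?_) (fun w _ _ hw => ?_)
    (fun w _ => Finset.mem_univ _) (fun w _ => ?_)
  · rw [Equiv.Perm.sign_mul, sign_simpleRefl, Equiv.Perm.coe_mul, ← rename_rename]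
    change _ + _ • rename w (swp K r f) = 0
    rw [h, mul_neg, mul_one, Units.smul_def, Units.smul_def, Units.val_neg, neg_smul,
      add_neg_cancel]
  · have : simpleRefl r = 1 := by simpa using hw
    have h2 := sign_simpleRefl r
    rw [this, Equiv.Perm.sign_one] at h2
    exact absurd h2 (by decide)
  · rw [mul_assoc, simpleRefl_mul_self, mul_one]

/-- Divided differences are self-adjoint for the form `(f, g) ↦ ∑_w sgn(w) w(f g)`. -/
theorem alt_mul_ddiff (r : Fin (n - 1)) (f g : MvPolynomial (Fin n) K) :
    alt K n (f * ddiff K r g) = alt K n (ddiff K r f * g) := by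
  rw [← sub_eq_zero, ← map_sub]
  refine alt_eq_zero (r := r) (mul_left_cancel₀ (xdiff_ne_zero r) ?_)
  have h1 := xdiff_mul_ddiff r f
  have h2 := xdiff_mul_ddiff r g
  simp only [map_sub, map_mul, swp_ddiff]
  linear_combination (swp K r f - f) * h2 - (swp K r g - g) * h1

theorem alt_mul_of_isSymmetric (f : MvPolynomial (Fin n) K) {g : MvPolynomial (Fin n) K}
    (hg : g.IsSymmetric) : alt K n (f * g) = alt K n f * g := by
  simp only [alt_apply, map_mul, hg _, Finset.sum_mul, smul_mul_assoc]

theorem rename_alt (w : Equiv.Perm (Fin n)) (f : MvPolynomial (Fin n) K) :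
    rename w (alt K n f) = Equiv.Perm.sign w • alt K n f := by
  rw [alt_apply, Finset.smul_sum, map_sum]
  refine Fintype.sum_equiv (Equiv.mulLeft w) _ _ fun v => ?_
  rw [Equiv.coe_mulLeft, Equiv.Perm.sign_mul, smul_smul, ← mul_assoc, Int.units_mul_self,
    one_mul, Equiv.Perm.coe_mul, ← rename_rename, Units.smul_def, map_zsmul, Units.smul_def]

theorem isSymmetric_of_swp {f : MvPolynomial (Fin n) K} (h : ∀ r, swp K r f = f) :
    f.IsSymmetric := by
  intro w
  obtain ⟨l, rfl⟩ := exists_wordPerm_eq w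
  induction l with
  | nil => simp [wordPerm]
  | cons r l ih => rw [wordPerm_cons, Equiv.Perm.coe_mul, ← rename_rename, ih, h]

theorem alternant_eq_zero {c : Fin n → ℕ} (h : ¬ Function.Injective c) : alternant K c = 0 := by
  simp only [Function.Injective, not_forall] at h
  obtain ⟨i, j, hc, hij⟩ := h
  rw [alternant_eq_det]
  exact Matrix.det_zero_of_column_eq hij fun k => by simp [hc]

theorem alternant_comp (c : Fin n → ℕ) (w : Equiv.Perm (Fin n)) :
    alternant K (c ∘ w) = Equiv.Perm.sign w • alternant K c := by
  rw [alternant_eq_det, alternant_eq_det, Units.smul_def, zsmul_eq_mul, ← Matrix.det_permute']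
  rfl

theorem addDelta_strictAnti {μ : Fin n → ℕ} (h : Antitone μ) : StrictAnti (addDelta μ) := by
  intro i j hij
  have h1 := h hij.le
  have h2 : i.val < j.val := hij
  simp only [addDelta]
  omega

theorem addDelta_injective : Function.Injective (addDelta (n := n)) := by
  intro μ ν h
  funext i
  simpa [addDelta] using congrFun h i

theorem exists_addDelta_eq {c : Fin n → ℕ} (h : StrictAnti c) :
    ∃ μ : Partitions n, addDelta μ.1 = c := by
  have key : ∀ (d : ℕ) (i j : Fin n), j.val = i.val + d → c j + d ≤ c i := by
    intro d
    induction d with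
    | zero => intro i j hij; rw [show j = i from Fin.ext hij]; simp
    | succ d ih =>
      intro i j hij
      have h1 := ih i ⟨i.val + d, by omega⟩ rfl
      have h2 : c j < c ⟨i.val + d, by omega⟩ := h (show i.val + d < j.val by omega)
      omega
  refine ⟨⟨fun i => c i - (n - 1 - i.val), fun i j hij => ?_⟩, funext fun i => ?_⟩
  · have hij' : i.val ≤ j.val := hij
    have h1 := key (j.val - i.val) i j (by omega)
    simp only
    omega
  · have hi := i.isLt
    have h1 := key (n - 1 - i.val) i ⟨n - 1, by omega⟩ (show n - 1 = _ by omega)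
    simp only [addDelta]
    omega

/-- Every alternant is zero or, up to sign, an alternant of the form `a_{μ + δ}`. -/
theorem alternant_cases (c : Fin n → ℕ) :
    alternant K c = 0 ∨ ∃ (μ : Partitions n) (w : Equiv.Perm (Fin n)),
      alternant K c = Equiv.Perm.sign w • alternant K (addDelta μ.1) := by
  by_cases h : Function.Injective c
  · right
    have hm : Antitone (c ∘ Tuple.sort c ∘ Fin.rev) :=
      (Tuple.monotone_sort c).comp_antitone Fin.rev_anti
    have hs : StrictAnti (c ∘ Tuple.sort c ∘ Fin.rev) :=
      hm.strictAnti_of_injective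
        (h.comp ((Tuple.sort c).injective.comp Fin.rev_injective))
    obtain ⟨μ, hμ⟩ := exists_addDelta_eq hs
    refine ⟨μ, (Fin.revPerm.trans (Tuple.sort c)), ?_⟩
    rw [hμ, show c ∘ Tuple.sort c ∘ Fin.rev = c ∘ (Fin.revPerm.trans (Tuple.sort c)) from rfl,
      alternant_comp, smul_smul, Int.units_mul_self, one_smul]
  · exact .inl (alternant_eq_zero h)

theorem coeff_alternant (c d : Fin n → ℕ) :
    coeff (Finsupp.equivFunOnFinite.symm d) (alternant K c) =
      ∑ w : Equiv.Perm (Fin n), if c ∘ w.symm = d then ((Equiv.Perm.sign w : ℤ) : K) else 0 := by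
  rw [← alt_mono, alt_apply, coeff_sum]
  refine Finset.sum_congr rfl fun w _ => ?_
  rw [rename_mono, Units.smul_def, coeff_smul, coeff_mono, zsmul_eq_mul]
  split_ifs <;> simp

/-- The coefficient of `x^{ν + δ}` in `a_{μ + δ}`. -/
theorem coeff_alternant_addDelta [DecidableEq (Partitions n)] (μ ν : Partitions n) :
    coeff (Finsupp.equivFunOnFinite.symm (addDelta ν.1)) (alternant K (addDelta μ.1)) =
      if μ = ν then 1 else 0 := by
  have key : ∀ w : Equiv.Perm (Fin n), addDelta μ.1 ∘ w.symm = addDelta ν.1 → w = 1 := by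
    intro w hw
    have hmono : StrictMono w.symm := by
      intro i j hij
      have h1 := addDelta_strictAnti ν.2 hij
      rw [← hw] at h1
      exact (addDelta_strictAnti μ.2).lt_iff_gt.1 h1
    have h2 := (hmono.range_inj strictMono_id).1 (by simp)
    ext i
    have h3 := congrFun h2 (w i)
    simp only [Equiv.symm_apply_apply, id] at h3
    rw [← h3]
    rfl
  rw [coeff_alternant, Finset.sum_eq_single 1]
  · have : ((1 : Equiv.Perm (Fin n)).symm : Fin n → Fin n) = id := rfl
    rw [this, Function.comp_id, Equiv.Perm.sign_one]
    by_cases h : μ = ν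
    · rw [if_pos h, if_pos (by rw [h])]
      simp
    · rw [if_neg h, if_neg fun h' => h (Subtype.ext (addDelta_injective h'))]
  · exact fun w _ hw => if_neg fun h => hw (key w h)
  · simp

theorem coeff_alternant_of_le {c d : Fin n → ℕ} {ℓ : ℕ} {i : Fin n} (hc : ℓ ≤ c i)
    (hd : ∀ j, d j < ℓ) : coeff (Finsupp.equivFunOnFinite.symm d) (alternant K c) = 0 := by
  rw [coeff_alternant]
  refine Finset.sum_eq_zero fun w _ => if_neg fun h => ?_
  have h1 := congrFun h (w i)
  have h2 := hd (w i)
  simp only [Function.comp_apply, Equiv.symm_apply_apply] at h1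
  omega

/-- The partition `0`. -/
def zeroPartition (n : ℕ) : Partitions n := ⟨0, fun _ _ _ => le_rfl⟩

theorem alternant_delta_ne_zero : alternant K (addDelta (0 : Fin n → ℕ)) ≠ 0 := by
  classical
  intro h
  have h1 := coeff_alternant_addDelta (K := K) (zeroPartition n) (zeroPartition n)
  rw [if_pos rfl] at h1
  change coeff _ (alternant K (addDelta (0 : Fin n → ℕ))) = 1 at h1
  rw [h, coeff_zero] at h1
  exact zero_ne_one h1

theorem schur_zero : schur K (zeroPartition n) = 1 := by
  refine mul_left_cancel₀ (alternant_delta_ne_zero (K := K)) ?_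
  rw [← schur_spec, mul_one]
  rfl

theorem schur_isSymmetric (μ : Partitions n) : (schur K μ).IsSymmetric := by
  intro w
  have h := congrArg (rename w) (schur_spec K μ)
  rw [map_mul, ← alt_mono, ← alt_mono, rename_alt, rename_alt, smul_mul_assoc] at h
  refine (mul_left_cancel₀ (alternant_delta_ne_zero (K := K)) ?_).symm
  rw [← alt_mono, ← (MulAction.injective (Equiv.Perm.sign w)).eq_iff, ← h, alt_mono, alt_mono,
    ← schur_spec]

/-- Schur polynomials span the symmetric polynomials: `a_δ p` is the alternating sum of `x^δ p`. -/
theorem mem_span_schur {p : MvPolynomial (Fin n) K} (hp : p.IsSymmetric) :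
    p ∈ Submodule.span K (Set.range (schur K (n := n))) := by
  have key : ∀ f : MvPolynomial (Fin n) K, ∃ g ∈ Submodule.span K (Set.range (schur K (n := n))),
      alt K n f = alternant K (addDelta (0 : Fin n → ℕ)) * g := by
    intro f
    induction f using mono_induction with
    | hmono c =>
      rw [alt_mono]
      rcases alternant_cases (K := K) c with h | ⟨μ, w, h⟩
      · exact ⟨0, Submodule.zero_mem _, by rw [h, mul_zero]⟩
      · refine ⟨(Equiv.Perm.sign w : ℤ) • schur K μ,
          zsmul_mem (Submodule.subset_span (Set.mem_range_self μ)) _, ?_⟩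
        rw [h, schur_spec, mul_smul_comm, Units.smul_def]
    | hadd f g hf hg =>
      obtain ⟨u, hu, hu'⟩ := hf
      obtain ⟨v, hv, hv'⟩ := hg
      exact ⟨u + v, add_mem hu hv, by rw [map_add, hu', hv', mul_add]⟩
    | hsmul a f hf =>
      obtain ⟨u, hu, hu'⟩ := hf
      exact ⟨a • u, Submodule.smul_mem _ a hu, by rw [map_smul, hu', mul_smul_comm]⟩
  obtain ⟨g, hg, h⟩ := key (mono K (addDelta 0) * p)
  rw [alt_mul_of_isSymmetric _ hp, alt_mono] at h
  rwa [mul_left_cancel₀ alternant_delta_ne_zero h]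

/-- The divided difference of a monomial in which the exponents of `x_r` and `x_{r+1}` differ by
one. -/
theorem ddiff_mono {r : Fin (n - 1)} {c d : Fin n → ℕ} (hlo : c (lo r) = d (lo r) + 1)
    (hd : d (lo r) = d (hi r)) (hc : ∀ i, i ≠ lo r → c i = d i) :
    ddiff K r (mono K c) = -mono K d := by
  have h1 : mono K c = X (lo r) * mono K d := by
    have h2 : c = Pi.single (lo r) 1 + d := by
      funext i
      by_cases h : i = lo r
      · subst h
        simp [hlo, add_comm]
      · simp [h, hc i h]
    rw [h2, mono_add]
    congr 1
    rw [mono, Finset.prod_eq_single (lo r)]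
    · simp
    · intro i _ hi
      simp [hi]
    · simp
  have h3 : swp K r (mono K d) = mono K d := by
    rw [swp, rename_mono]
    congr 1
    funext i
    simp only [simpleRefl, Equiv.symm_swap, Function.comp_apply, Equiv.swap_apply_def]
    split_ifs with h4 h5
    · rw [h4, hd]
    · rw [h5, hd]
    · rfl
  rw [h1, ddiff_mul, ddiff_eq_zero_iff.2 h3, ddiff_X_lo]
  ring

end Alternating

/-! ### The nilHecke algebra: polynomials, the polynomial representation, the anti-involution -/

section Algebra

open MvPolynomial

variable {K : Type*} [Field K] {n : ℕ}

theorem psi_mul_self (r : Fin (n - 1)) : psi K r * psi K r = 0 := by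
  have h := RingQuot.mkAlgHom_rel K (Rel.psi_sq (K := K) r)
  rwa [pow_two, map_mul, map_zero] at h

theorem psi_comm (r k : Fin (n - 1)) (h : k.val + 1 < r.val) :
    psi K r * psi K k = psi K k * psi K r := by
  simpa only [psi, y, map_mul] using RingQuot.mkAlgHom_rel K (Rel.psi_comm (K := K) r k h)

theorem psi_braid (r r' : Fin (n - 1)) (h : r'.val = r.val + 1) :
    psi K r * psi K r' * psi K r = psi K r' * psi K r * psi K r' := by
  simpa only [psi, y, map_mul] using RingQuot.mkAlgHom_rel K (Rel.braid (K := K) r r' h)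

theorem y_comm (r k : Fin n) : y K r * y K k = y K k * y K r := by
  simpa only [psi, y, map_mul] using RingQuot.mkAlgHom_rel K (Rel.y_comm (K := K) r k)

theorem psi_mul_y_hi (r : Fin (n - 1)) : psi K r * y K (hi r) = y K (lo r) * psi K r + 1 := by
  simpa only [psi, y, map_mul, map_add, map_one] using
    RingQuot.mkAlgHom_rel K (Rel.psi_y_hi (K := K) r)

theorem y_hi_mul_psi (r : Fin (n - 1)) : y K (hi r) * psi K r = psi K r * y K (lo r) + 1 := by
  simpa only [psi, y, map_mul, map_add, map_one] using
    RingQuot.mkAlgHom_rel K (Rel.y_hi_psi (K := K) r)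

theorem psi_mul_y (r : Fin (n - 1)) (k : Fin n) (h₁ : k ≠ lo r) (h₂ : k ≠ hi r) :
    psi K r * y K k = y K k * psi K r := by
  simpa only [psi, y, map_mul] using RingQuot.mkAlgHom_rel K (Rel.psi_y (K := K) r k h₁ h₂)

theorem alg_induction {p : Alg K n → Prop} (h : Alg K n)
    (hscalar : ∀ a : K, p (algebraMap K _ a)) (hpsi : ∀ r, p (psi K r)) (hy : ∀ k, p (y K k))
    (hadd : ∀ a b, p a → p b → p (a + b)) (hmul : ∀ a b, p a → p b → p (a * b)) : p h := by
  obtain ⟨x, rfl⟩ := RingQuot.mkAlgHom_surjective K (Rel K (n := n)) h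
  induction x using FreeAlgebra.induction with
  | grade0 a => rw [AlgHom.commutes]; exact hscalar a
  | grade1 g =>
    cases g with
    | psi r => exact hpsi r
    | y k => exact hy k
  | mul a b ha hb => rw [map_mul]; exact hmul _ _ ha hb
  | add a b ha hb => rw [map_add]; exact hadd _ _ ha hb

/-- The algebra homomorphism out of `H_n` given by images of the generators satisfying the
relations. -/
def liftAlg {B : Type*} [Ring B] [Algebra K B] (p : Fin (n - 1) → B) (x : Fin n → B)
    (psi_sq : ∀ r, p r * p r = 0)
    (psi_comm : ∀ r k : Fin (n - 1), k.val + 1 < r.val → p r * p k = p k * p r)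
    (braid : ∀ r r' : Fin (n - 1), r'.val = r.val + 1 → p r * p r' * p r = p r' * p r * p r')
    (y_comm : ∀ r k, x r * x k = x k * x r)
    (psi_y_hi : ∀ r, p r * x (hi r) = x (lo r) * p r + 1)
    (y_hi_psi : ∀ r, x (hi r) * p r = p r * x (lo r) + 1)
    (psi_y : ∀ (r : Fin (n - 1)) (k : Fin n), k ≠ lo r → k ≠ hi r → p r * x k = x k * p r) :
    Alg K n →ₐ[K] B :=
  RingQuot.liftAlgHom K ⟨FreeAlgebra.lift K fun | Gen.psi r => p r | Gen.y k => x k, by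
    intro a b h
    cases h with
    | psi_sq r => simpa [fpsi, pow_two] using psi_sq r
    | psi_comm r k h => simpa [fpsi] using psi_comm r k h
    | braid r r' h => simpa [fpsi] using braid r r' h
    | y_comm r k => simpa [fy] using y_comm r k
    | psi_y_hi r => simpa [fpsi, fy] using psi_y_hi r
    | y_hi_psi r => simpa [fpsi, fy] using y_hi_psi r
    | psi_y r k h₁ h₂ => simpa [fpsi, fy] using psi_y r k h₁ h₂⟩

section liftAlg

variable {B : Type*} [Ring B] [Algebra K B] {p : Fin (n - 1) → B} {x : Fin n → B}
  {h1 h2 h3 h4 h5 h6 h7}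

@[simp] theorem liftAlg_psi (r : Fin (n - 1)) :
    liftAlg (K := K) p x h1 h2 h3 h4 h5 h6 h7 (psi K r) = p r := by
  simp [liftAlg, psi, fpsi]

@[simp] theorem liftAlg_y (k : Fin n) :
    liftAlg (K := K) p x h1 h2 h3 h4 h5 h6 h7 (y K k) = x k := by
  simp [liftAlg, y, fy]

end liftAlg

variable (K n) in
/-- The polynomial representation: `ψ_r` acts by a divided difference operator and `y_k` by
multiplication with `x_k`. -/
def rep : Alg K n →ₐ[K] Module.End K (MvPolynomial (Fin n) K) :=
  liftAlg (ddiff K) (fun k => LinearMap.mulLeft K (X k))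
    (fun r => LinearMap.ext fun f => by
      rw [Module.End.mul_apply, ddiff_ddiff, LinearMap.zero_apply])
    (fun r k h => LinearMap.ext fun f => by
      rw [Module.End.mul_apply, Module.End.mul_apply, ddiff_comm r k h f])
    (fun r r' h => LinearMap.ext fun f => by
      simp only [Module.End.mul_apply, ddiff_braid r r' h f])
    (fun r k => LinearMap.ext fun f => by
      simp only [Module.End.mul_apply, LinearMap.mulLeft_apply, mul_left_comm])
    (fun r => LinearMap.ext fun f => by
      simp only [Module.End.mul_apply, LinearMap.mulLeft_apply, LinearMap.add_apply,
        Module.End.one_apply]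
      rw [ddiff_mul, swp_X_hi, ddiff_X_hi, one_mul])
    (fun r => LinearMap.ext fun f => by
      simp only [Module.End.mul_apply, LinearMap.mulLeft_apply, LinearMap.add_apply,
        Module.End.one_apply]
      rw [ddiff_mul, swp_X_lo, ddiff_X_lo]
      ring)
    (fun r k h₁ h₂ => LinearMap.ext fun f => by
      simp only [Module.End.mul_apply, LinearMap.mulLeft_apply]
      rw [ddiff_mul, swp_X_of_ne r k h₁ h₂, ddiff_X_of_ne r k h₁ h₂, zero_mul, add_zero])

@[simp] theorem rep_psi (r : Fin (n - 1)) (f : MvPolynomial (Fin n) K) :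
    rep K n (psi K r) f = ddiff K r f := by
  simp [rep]

@[simp] theorem rep_y (k : Fin n) (f : MvPolynomial (Fin n) K) :
    rep K n (y K k) f = X k * f := by
  simp [rep]

variable (K n) in
/-- The anti-involution of `H_n` fixing the generators, as a homomorphism to the opposite
algebra. -/
def antiHom : Alg K n →ₐ[K] (Alg K n)ᵐᵒᵖ :=
  liftAlg (fun r => .op (psi K r)) (fun k => .op (y K k))
    (fun r => congrArg MulOpposite.op (psi_mul_self r))
    (fun r k h => congrArg MulOpposite.op (psi_comm r k h).symm)
    (fun r r' h => MulOpposite.unop_injective (by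
      simpa [mul_assoc] using psi_braid r r' h))
    (fun r k => congrArg MulOpposite.op (y_comm k r))
    (fun r => congrArg MulOpposite.op (y_hi_mul_psi r))
    (fun r => congrArg MulOpposite.op (psi_mul_y_hi r))
    (fun r k h₁ h₂ => congrArg MulOpposite.op (psi_mul_y r k h₁ h₂).symm)

/-- The anti-involution of `H_n` fixing the generators. -/
def anti (h : Alg K n) : Alg K n := (antiHom K n h).unop

@[simp] theorem anti_psi (r : Fin (n - 1)) : anti (psi K r) = psi K r := by
  simp [anti, antiHom]

@[simp] theorem anti_y (k : Fin n) : anti (y K k) = y K k := by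
  simp [anti, antiHom]

@[simp] theorem anti_mul (a b : Alg K n) : anti (a * b) = anti b * anti a := by
  simp [anti]

@[simp] theorem anti_add (a b : Alg K n) : anti (a + b) = anti a + anti b := by
  simp [anti]

@[simp] theorem anti_algebraMap (a : K) :
    anti (algebraMap K (Alg K n) a) = algebraMap K (Alg K n) a := by
  simp [anti]

theorem anti_zero : anti (0 : Alg K n) = 0 := by simp [anti]

theorem anti_anti (h : Alg K n) : anti (anti h) = h := by
  induction h using alg_induction with
  | hscalar a => simp
  | hpsi r => simp
  | hy k => simp
  | hadd a b ha hb => simp [ha, hb]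
  | hmul a b ha hb => simp [ha, hb]

/-- The `y_k` generate a commutative subalgebra, in which polynomials can be evaluated. -/
instance : IsMulCommutative (Algebra.adjoin K (Set.range (y K (n := n)))) :=
  Algebra.isMulCommutative_adjoin K (by
    rintro _ ⟨r, rfl⟩ _ ⟨k, rfl⟩
    exact y_comm r k)

open scoped IsMulCommutative in
variable (K n) in
/-- The homomorphism `f ↦ f(y_1, …, y_n)` to `H_n`. -/
def pol : MvPolynomial (Fin n) K →ₐ[K] Alg K n :=
  (Algebra.adjoin K (Set.range (y K (n := n)))).val.comp
    (aeval (S₁ := Algebra.adjoin K (Set.range (y K (n := n)))) fun k =>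
      ⟨y K k, Algebra.subset_adjoin (Set.mem_range_self k)⟩)

open scoped IsMulCommutative in
@[simp] theorem pol_X (k : Fin n) : pol K n (X k) = y K k := by
  rw [pol, AlgHom.comp_apply, aeval_X]
  rfl

theorem algHom_mono {A : Type*} [Ring A] [Algebra K A] (φ : MvPolynomial (Fin n) K →ₐ[K] A)
    (c : Fin n → ℕ) : φ (mono K c) = (List.ofFn fun i => φ (X i) ^ c i).prod := by
  rw [mono, ← List.prod_ofFn, map_list_prod, List.map_ofFn]
  congr 2
  funext i
  simp

theorem algHom_eq_evalAt {A : Type*} [Ring A] [Algebra K A] (φ : MvPolynomial (Fin n) K →ₐ[K] A)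
    (f : MvPolynomial (Fin n) K) : φ f = evalAt (fun i => φ (X i)) f := by
  conv_lhs => rw [f.as_sum]
  rw [map_sum]
  refine Finset.sum_congr rfl fun m _ => ?_
  rw [← algHom_mono φ m, ← map_smul, mono_eq_monomial, smul_monomial, smul_eq_mul, mul_one]
  exact congrArg (fun v => φ (monomial v (coeff m f)))
    (Finsupp.equivFunOnFinite.symm_apply_apply m).symm

theorem pol_eq_evalAt (f : MvPolynomial (Fin n) K) : pol K n f = evalAt (y K) f := by
  simpa only [pol_X] using algHom_eq_evalAt (pol K n) f

theorem pol_mono (c : Fin n → ℕ) : pol K n (mono K c) = (List.ofFn fun i => y K i ^ c i).prod := by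
  simpa only [pol_X] using algHom_mono (pol K n) c

theorem pol_comm (f g : MvPolynomial (Fin n) K) :
    pol K n f * pol K n g = pol K n g * pol K n f := by
  rw [← map_mul, mul_comm, map_mul]

theorem anti_pol (f : MvPolynomial (Fin n) K) : anti (pol K n f) = pol K n f := by
  induction f using MvPolynomial.induction_on with
  | C a => rw [← MvPolynomial.algebraMap_eq, AlgHom.commutes, anti_algebraMap]
  | add f g hf hg => simp [hf, hg]
  | mul_X f k hf =>
    rw [map_mul, anti_mul, hf, pol_X, anti_y, ← pol_X, pol_comm]

theorem rep_pol (f g : MvPolynomial (Fin n) K) : rep K n (pol K n f) g = f * g := by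
  induction f using MvPolynomial.induction_on generalizing g with
  | C a =>
    rw [← MvPolynomial.algebraMap_eq, AlgHom.commutes, AlgHom.commutes, Module.algebraMap_end_apply,
      Algebra.smul_def]
  | add f g hf hg => simp [hf, hg, add_mul]
  | mul_X f k hf => simp [hf, mul_assoc]

/-- Moving `ψ_r` to the left of a polynomial. -/
theorem pol_mul_psi (r : Fin (n - 1)) (f : MvPolynomial (Fin n) K) :
    pol K n f * psi K r = psi K r * pol K n (swp K r f) + pol K n (ddiff K r f) := by
  induction f using MvPolynomial.induction_on with
  | C a =>
    have h : ddiff K r (C a) = 0 := ddiff_eq_zero_iff.2 (by simp)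
    rw [h, ← MvPolynomial.algebraMap_eq, AlgHom.commutes, AlgHom.commutes, AlgHom.commutes,
      Algebra.commutes, map_zero, add_zero]
  | add f g hf hg =>
    simp only [map_add, add_mul, mul_add, hf, hg]
    abel
  | mul_X f k hf =>
    have hk : y K k * psi K r = psi K r * pol K n (swp K r (X k)) + pol K n (ddiff K r (X k)) := by
      by_cases h₁ : k = lo r
      · subst h₁
        rw [swp_X_lo, ddiff_X_lo, pol_X, psi_mul_y_hi, map_neg, map_one]
        abel
      by_cases h₂ : k = hi r
      · subst h₂
        rw [swp_X_hi, ddiff_X_hi, pol_X, y_hi_mul_psi, map_one]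
      rw [swp_X_of_ne r k h₁ h₂, ddiff_X_of_ne r k h₁ h₂, pol_X, psi_mul_y r k h₁ h₂, map_zero,
        add_zero]
    -- the Leibniz rule for `x_k f`, with the roles of the factors exchanged
    rw [mul_comm f, ddiff_mul]
    simp only [map_mul, map_add, pol_X]
    rw [← pol_X k, pol_comm (X k) f, mul_assoc, pol_X, hk, mul_add, ← mul_assoc, hf, add_mul,
      pol_comm (swp K r (X k)) (ddiff K r f), pol_comm (ddiff K r (X k)) f, mul_assoc,
      pol_comm (swp K r (X k)), add_assoc]

/-- Symmetric polynomials in the `y_k` are central in `H_n`. -/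
theorem pol_commute {f : MvPolynomial (Fin n) K} (hf : f.IsSymmetric) (h : Alg K n) :
    pol K n f * h = h * pol K n f := by
  induction h using alg_induction with
  | hscalar a => exact (Algebra.commutes a _).symm
  | hpsi r =>
    have h1 : swp K r f = f := hf _
    rw [pol_mul_psi, h1, ddiff_eq_zero_iff.2 h1, map_zero, add_zero]
  | hy k => rw [← pol_X, pol_comm]
  | hadd a b ha hb => rw [mul_add, add_mul, ha, hb]
  | hmul a b ha hb => rw [← mul_assoc, ha, mul_assoc, hb, mul_assoc]

theorem psi_mul_mem_J (r : Fin (n - 1)) (h : Alg K n) : psi K r * h ∈ J K n :=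
  Submodule.mem_iSup_of_mem r ⟨h, rfl⟩

/-- Induction on the elements of `J_n`. -/
theorem J_induction {p : Alg K n → Prop} {j : Alg K n} (hj : j ∈ J K n) (zero : p 0)
    (psi : ∀ r h, p (psi K r * h)) (add : ∀ a b, p a → p b → p (a + b)) : p j := by
  refine Submodule.iSup_induction _ (motive := p) hj ?_ zero add
  rintro r _ ⟨h, rfl⟩
  exact psi r h

theorem J_mul_mem {j : Alg K n} (hj : j ∈ J K n) (h : Alg K n) : j * h ∈ J K n := by
  refine J_induction (p := fun j => j * h ∈ J K n) hj ?_ (fun r a => ?_) fun a b ha hb => ?_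
  · rw [zero_mul]; exact zero_mem _
  · rw [mul_assoc]; exact psi_mul_mem_J r _
  · rw [add_mul]; exact add_mem ha hb

/-- Modulo the right ideal `J_n` every element is a polynomial: `H_n / J_n` is the polynomial
representation, turned into a right module by the anti-involution. -/
theorem pol_mul_sub_mem_J (h : Alg K n) (f : MvPolynomial (Fin n) K) :
    pol K n f * h - pol K n (rep K n (anti h) f) ∈ J K n := by
  induction h using alg_induction generalizing f with
  | hscalar a =>
    rw [anti_algebraMap, AlgHom.commutes, Module.algebraMap_end_apply, map_smul, Algebra.smul_def,
      Algebra.commutes, sub_self]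
    exact zero_mem _
  | hpsi r =>
    rw [anti_psi, rep_psi, pol_mul_psi, add_sub_cancel_right]
    exact psi_mul_mem_J r _
  | hy k =>
    rw [anti_y, rep_y, map_mul, pol_X, ← pol_X, pol_comm, sub_self]
    exact zero_mem _
  | hadd a b ha hb =>
    have := add_mem (ha f) (hb f)
    rw [anti_add, map_add, mul_add, LinearMap.add_apply, map_add, add_sub_add_comm]
    exact this
  | hmul a b ha hb =>
    have := add_mem (J_mul_mem (ha f) b) (hb (rep K n (anti a) f))
    rw [sub_mul, sub_add_sub_cancel] at this
    rwa [anti_mul, map_mul, Module.End.mul_apply, ← mul_assoc]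

theorem sub_mem_J (h : Alg K n) : h - pol K n (rep K n (anti h) 1) ∈ J K n := by
  simpa using pol_mul_sub_mem_J h 1

theorem rep_anti_of_mem_J {j : Alg K n} (hj : j ∈ J K n) : rep K n (anti j) 1 = 0 := by
  refine J_induction (p := fun j => rep K n (anti j) 1 = 0) hj ?_ (fun r a => ?_)
    fun a b ha hb => ?_
  · simp [anti_zero]
  · rw [anti_mul, map_mul, Module.End.mul_apply, anti_psi, rep_psi,
      ddiff_eq_zero_iff.2 (map_one _), map_zero]
  · simp [ha, hb]

/-- Distinct polynomials in the `y_k` are incongruent modulo `J_n`. -/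
theorem eq_zero_of_pol_mem_J {f : MvPolynomial (Fin n) K} (hf : pol K n f ∈ J K n) : f = 0 := by
  simpa [anti_pol, rep_pol] using rep_anti_of_mem_J hf

/-- The anti-involution is adjunction for the form `(f, g) ↦ ∑_w sgn(w) w(f g)`. -/
theorem alt_mul_rep (h : Alg K n) (f g : MvPolynomial (Fin n) K) :
    alt K n (f * rep K n h g) = alt K n (rep K n (anti h) f * g) := by
  induction h using alg_induction generalizing f g with
  | hscalar a => simp
  | hpsi r => simpa using alt_mul_ddiff r f g
  | hy k => simp [mul_left_comm, mul_assoc]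
  | hadd a b ha hb => simp [mul_add, add_mul, ha, hb]
  | hmul a b ha hb => simp [ha, hb]

end Algebra

/-! ### The element of the longest permutation -/

section Longest

open MvPolynomial

variable {K : Type*} [Field K] {n : ℕ}

variable (K) in
/-- The product of the `ψ_r` along the longest canonical word in the letters `0, …, m - 1`. -/
def psiLong (m : ℕ) (h : m ≤ n - 1) : Alg K n := ((longWord n m h).map (psi K)).prod

theorem psiPerm_longest : psiPerm K (longest n) = psiLong K (n - 1) le_rfl :=
  prod_reducedExpr_longest psi_mul_self psi_comm psi_braid

theorem psi_mul_psiLong {m : ℕ} (h : m ≤ n - 1) {r : Fin (n - 1)} (hr : r.val < m) :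
    psi K r * psiLong K m h = 0 := by
  have := prod_eq_zero_of_length_lt (g := psi K) psi_mul_self psi_comm psi_braid h
    (r :: longWord n m h) (by simpa [hr] using longWord_lt m h) (by simp)
  simpa [psiLong] using this

theorem psiLong_mul_psi {m : ℕ} (h : m ≤ n - 1) {r : Fin (n - 1)} (hr : r.val < m) :
    psiLong K m h * psi K r = 0 := by
  have := prod_eq_zero_of_length_lt (g := psi K) psi_mul_self psi_comm psi_braid h
    (longWord n m h ++ [r]) (by
      intro k hk
      rcases List.mem_append.1 hk with hk | hk
      · exact longWord_lt m h k hk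
      · rwa [List.mem_singleton.1 hk]) (by simp)
  simpa [psiLong] using this

theorem psiPerm_longest_mul_psi (r : Fin (n - 1)) : psiPerm K (longest n) * psi K r = 0 := by
  rw [psiPerm_longest, psiLong_mul_psi le_rfl r.isLt]

theorem psiPerm_longest_mul_of_mem_J {j : Alg K n} (hj : j ∈ J K n) :
    psiPerm K (longest n) * j = 0 := by
  refine J_induction (p := fun j => psiPerm K (longest n) * j = 0) hj (mul_zero _) (fun r a => ?_)
    fun a b ha hb => ?_
  · rw [← mul_assoc, psiPerm_longest_mul_psi, zero_mul]
  · rw [mul_add, ha, hb, add_zero]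

theorem psiLong_mul_y {m : ℕ} (h : m ≤ n - 1) {k : Fin n} (hk : m < k.val) :
    psiLong K m h * y K k = y K k * psiLong K m h := by
  have key : ∀ l : List (Fin (n - 1)), (∀ r ∈ l, r.val < m) →
      (l.map (psi K)).prod * y K k = y K k * (l.map (psi K)).prod := by
    intro l
    induction l with
    | nil => simp
    | cons r l ih =>
      intro hl
      have h1 := hl r List.mem_cons_self
      rw [List.map_cons, List.prod_cons, mul_assoc, ih fun a ha => hl a (List.mem_cons_of_mem _ ha),
        ← mul_assoc, psi_mul_y r k (Fin.ne_of_val_ne (by simp [lo]; omega))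
          (Fin.ne_of_val_ne (by simp [hi]; omega)), mul_assoc]
  exact key _ (longWord_lt m h)

/-- Multiplication with `y_{m+1}` removes the first letter of the segment `a, …, m`, up to a
left multiple of the original product: the other terms of the commutator end in some
`ψ_r ψ_{w_{0,m}} = 0`. -/
theorem seg_mul_y_mul_psiLong {m : ℕ} (hm : m + 1 ≤ n - 1) (a d : ℕ) (h : a + (d + 1) = m + 1) :
    ((seg (n := n) a (d + 1) (h ▸ hm)).map (psi K)).prod * y K ⟨m + 1, by omega⟩ *
        psiLong K m (by omega) =
      y K ⟨a, by omega⟩ * ((seg (n := n) a (d + 1) (h ▸ hm)).map (psi K)).prod *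
          psiLong K m (by omega) +
        ((seg (n := n) (a + 1) d (by omega)).map (psi K)).prod * psiLong K m (by omega) := by
  induction d generalizing a with
  | zero =>
    obtain rfl : a = m := by omega
    have h1 := psi_mul_y_hi (K := K) (n := n) ⟨a, by omega⟩
    simp only [lo, hi] at h1
    simp [seg, h1, add_mul]
  | succ d ih =>
    have h1 := psi_mul_y_hi (K := K) (n := n) ⟨a, by omega⟩
    simp only [lo, hi] at h1
    have h2 : psi K ⟨a, by omega⟩ * (((seg (n := n) (a + 1 + 1) d (by omega)).map (psi K)).prod *
        psiLong K m (by omega)) = 0 := by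
      rw [← mul_assoc, seg_prod_comm _ _ _ _ fun k hk => (psi_comm k _ (by simp; omega)).symm,
        mul_assoc, psi_mul_psiLong _ (by simp; omega), mul_zero]
    have h3 := ih (a + 1) (by omega)
    rw [seg, List.map_cons, List.prod_cons, mul_assoc, mul_assoc, ← mul_assoc _ (y K _), h3,
      mul_add, h2, add_zero, ← mul_assoc, ← mul_assoc, h1, add_mul, one_mul, add_mul, mul_assoc,
      mul_assoc, mul_assoc, mul_assoc]

/-- The two-sided ideal generated by `ψ_{w_0}` is the whole algebra. -/
theorem one_mem_of_psiPerm_longest_mem {I : TwoSidedIdeal (Alg K n)}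
    (h : psiPerm K (longest n) ∈ I) : 1 ∈ I := by
  have step : ∀ (m : ℕ) (hm : m + 1 ≤ n - 1), psiLong K (m + 1) hm ∈ I →
      psiLong K m (by omega) ∈ I := by
    intro m hm h
    have hseg : ∀ a ≤ m + 1, ∀ (d : ℕ) (h : a + d = m + 1),
        ((seg (n := n) a d (h ▸ hm)).map (psi K)).prod * psiLong K m (by omega) ∈ I := by
      intro a
      induction a with
      | zero =>
        intro _ d hd
        obtain rfl : d = m + 1 := by omega
        simpa [psiLong, longWord] using h
      | succ a ih =>
        intro ha d hd
        have h1 := ih (by omega) (d + 1) (by omega)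
        have h2 := seg_mul_y_mul_psiLong (K := K) hm a d (by omega)
        rw [mul_assoc, ← psiLong_mul_y _ (by simp), ← mul_assoc, mul_assoc (y K _),
          ← sub_eq_iff_eq_add'] at h2
        rw [← h2]
        exact I.sub_mem (I.mul_mem_right _ _ h1) (I.mul_mem_left _ _ h1)
    simpa [seg] using hseg (m + 1) le_rfl 0 rfl
  have all : ∀ (m : ℕ) (hm : m ≤ n - 1), psiLong K m hm ∈ I → 1 ∈ I := by
    intro m
    induction m with
    | zero => intro hm h; simpa [psiLong, longWord] using h
    | succ m ih => exact fun hm h => ih _ (step m hm h)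
  rw [psiPerm_longest] at h
  exact all _ _ h

theorem neg_one_pow_mul_eq_smul {A : Type*} [Ring A] [Algebra K A] (k : ℕ) (a : A) :
    (-1) ^ k * a = ((-1) ^ k : K) • a := by
  rw [Algebra.smul_def, map_pow, map_neg, map_one]

/-- `ψ_{w_0}` maps `x^δ` to a sign. -/
theorem rep_psiPerm_longest_delta :
    rep K n (psiPerm K (longest n)) (mono K (addDelta 0)) = (-1) ^ (n * (n - 1) / 2) := by
  -- the exponents after the letters `a, …, m` and those of `longWord n m`
  let e : ℕ → ℕ → Fin n → ℕ := fun m a i =>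
    if i.val < a then n - 1 - m else min (n - 2 - m) (n - 1 - i.val)
  have hseg : ∀ (m : ℕ) (hm : m + 1 ≤ n - 1) (d a : ℕ) (h : a + d = m + 1),
      rep K n ((seg (n := n) a d (h ▸ hm)).map (psi K)).prod (mono K (e m (m + 1))) =
        (-1) ^ d * mono K (e m a) := by
    intro m hm d
    induction d with
    | zero =>
      intro a h
      obtain rfl : a = m + 1 := by omega
      simp [seg]
    | succ d ih =>
      intro a h
      have h1 : ddiff K (⟨a, by omega⟩ : Fin (n - 1)) (mono K (e m (a + 1))) =
          -mono K (e m a) := by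
        refine ddiff_mono ?_ ?_ fun i hi => ?_
        · simp only [e, lo]; split_ifs <;> omega
        · simp only [e, lo, hi]; split_ifs <;> omega
        · have : i.val ≠ a := fun h => hi (Fin.ext h)
          simp only [e]; split_ifs <;> omega
      rw [seg, List.map_cons, List.prod_cons, map_mul, Module.End.mul_apply, ih (a + 1) (by omega),
        neg_one_pow_mul_eq_smul (K := K), rep_psi, map_smul, h1, ← neg_one_pow_mul_eq_smul]
      ring
  have hlong : ∀ (m : ℕ) (hm : m ≤ n - 1),
      rep K n (psiLong K m hm) (mono K (addDelta 0)) =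
        (-1) ^ ((m + 1) * m / 2) * mono K (fun i => min (n - 1 - m) (n - 1 - i.val)) := by
    intro m hm
    rw [← longWord_length m hm]
    induction m with
    | zero =>
      have : addDelta 0 = fun i : Fin n => min (n - 1 - 0) (n - 1 - i.val) := by
        funext i
        simp [addDelta]
      simp [psiLong, longWord, this]
    | succ m ih =>
      have h1 := hseg m hm (m + 1) 0 (by omega)
      have h2 : (fun i : Fin n => min (n - 1 - m) (n - 1 - i.val)) = e m (m + 1) := by
        funext i
        simp only [e]
        split_ifs <;> omega
      have h3 : e m 0 = fun i : Fin n => min (n - 1 - (m + 1)) (n - 1 - i.val) := by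
        funext i
        simp only [e]
        split_ifs <;> omega
      have h4 : psiLong K (m + 1) hm =
          ((seg (n := n) 0 (m + 1) (by omega)).map (psi K)).prod * psiLong K m (by omega) := by
        simp [psiLong, longWord]
      rw [h4, map_mul, Module.End.mul_apply, ih, neg_one_pow_mul_eq_smul (K := K), map_smul, h2, h1,
        h3, longWord, List.length_append, seg_length, ← neg_one_pow_mul_eq_smul, ← mul_assoc,
        ← pow_add, add_comm]
  rcases Nat.eq_zero_or_pos n with rfl | hn
  · have h := hlong 0 le_rfl
    rw [psiPerm_longest, h]
    simp [mono]
  · rw [psiPerm_longest, hlong, Nat.sub_add_cancel hn]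
    simp [mono]

/-- The polynomial by which `ψ_{w_0}` acts from the right is symmetric. -/
theorem rep_anti_isSymmetric (f : MvPolynomial (Fin n) K) :
    (rep K n (anti (psiPerm K (longest n))) f).IsSymmetric := by
  refine isSymmetric_of_swp fun r => ddiff_eq_zero_iff.1 ?_
  have h : psi K r * anti (psiPerm K (longest n)) = 0 := by
    rw [← anti_psi, ← anti_mul, psiPerm_longest_mul_psi, anti_zero]
  rw [← rep_psi, ← Module.End.mul_apply, ← map_mul, h, map_zero, LinearMap.zero_apply]

/-- `ψ_{w_0}`, acting from the right on `H_n / J_n`, is up to sign the alternating sum divided by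
`a_δ`. -/
theorem delta_mul_rep_anti (f : MvPolynomial (Fin n) K) :
    alternant K (addDelta (0 : Fin n → ℕ)) * rep K n (anti (psiPerm K (longest n))) f =
      (-1) ^ (n * (n - 1) / 2) * alt K n f := by
  rw [← alt_mono, ← alt_mul_of_isSymmetric _ (rep_anti_isSymmetric f), alt_mul_rep, anti_anti,
    rep_psiPerm_longest_delta, neg_one_pow_mul_eq_smul (K := K), map_smul,
    ← neg_one_pow_mul_eq_smul]

theorem rep_anti_addDelta (μ : Partitions n) :
    rep K n (anti (psiPerm K (longest n))) (mono K (addDelta μ.1)) =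
      (-1) ^ (n * (n - 1) / 2) * schur K μ := by
  refine mul_left_cancel₀ (alternant_delta_ne_zero (K := K)) ?_
  rw [delta_mul_rep_anti, alt_mono, schur_spec, mul_left_comm]

theorem S_eq (μ : Partitions n) :
    S K μ = ((-1) ^ (n * (n - 1) / 2) : K) •
      (pol K n (mono K (addDelta μ.1)) * psiPerm K (longest n)) := by
  rw [pol_mono, S, mul_assoc]
  exact neg_one_pow_mul_eq_smul _ _

/-- The Schur polynomial is the symmetric polynomial congruent to `S_μ`. -/
theorem isSymmPart_schur (μ : Partitions n) : IsSymmPart K (S K μ) (pol K n (schur K μ)) := by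
  refine ⟨⟨schur K μ, schur_isSymmetric μ, pol_eq_evalAt _⟩, ?_⟩
  have h := Submodule.smul_mem _ ((-1) ^ (n * (n - 1) / 2) : K)
    (pol_mul_sub_mem_J (psiPerm K (longest n)) (mono K (addDelta μ.1)))
  rwa [rep_anti_addDelta, smul_sub, ← S_eq, neg_one_pow_mul_eq_smul (K := K), map_smul, smul_smul,
    ← mul_pow, neg_one_mul, neg_neg, one_pow, one_smul] at h

theorem IsSymmPart.unique {g z z' : Alg K n} (h : IsSymmPart K g z) (h' : IsSymmPart K g z') :
    z = z' := by
  obtain ⟨⟨p, -, rfl⟩, hz⟩ := h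
  obtain ⟨⟨q, -, rfl⟩, hz'⟩ := h'
  rw [← pol_eq_evalAt] at hz hz' ⊢
  rw [← pol_eq_evalAt]
  have h := sub_mem hz' hz
  rw [sub_sub_sub_cancel_left, ← map_sub] at h
  rw [sub_eq_zero.1 (eq_zero_of_pol_mem_J h)]

theorem zPart_eq (μ : Partitions n) : zPart K μ = pol K n (schur K μ) :=
  (Classical.epsilon_spec (p := IsSymmPart K (S K μ)) ⟨_, isSymmPart_schur μ⟩).unique
    (isSymmPart_schur μ)

/-- `ψ_{w_0} H_n ψ_{w_0}` consists of the multiples of `ψ_{w_0}` by symmetric polynomials. -/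
theorem psiPerm_longest_mul_mul (h : Alg K n) :
    ∃ q : MvPolynomial (Fin n) K, q.IsSymmetric ∧
      psiPerm K (longest n) * h * psiPerm K (longest n) = psiPerm K (longest n) * pol K n q := by
  refine ⟨_, rep_anti_isSymmetric (rep K n (anti h) 1), ?_⟩
  have h1 := psiPerm_longest_mul_of_mem_J (J_mul_mem (sub_mem_J h) (psiPerm K (longest n)))
  have h2 := psiPerm_longest_mul_of_mem_J
    (pol_mul_sub_mem_J (psiPerm K (longest n)) (rep K n (anti h) 1))
  rw [sub_mul, mul_sub, sub_eq_zero] at h1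
  rw [mul_sub, sub_eq_zero] at h2
  rw [mul_assoc, h1, h2]

theorem psiPerm_longest_mul_addDelta_mul (μ : Partitions n) :
    psiPerm K (longest n) * pol K n (mono K (addDelta μ.1)) * psiPerm K (longest n) =
      ((-1) ^ (n * (n - 1) / 2) : K) • (psiPerm K (longest n) * pol K n (schur K μ)) := by
  have h := psiPerm_longest_mul_of_mem_J
    (pol_mul_sub_mem_J (psiPerm K (longest n)) (mono K (addDelta μ.1)))
  rw [mul_sub, sub_eq_zero, rep_anti_addDelta, neg_one_pow_mul_eq_smul (K := K), map_smul,
    mul_smul_comm] at h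
  rw [mul_assoc, h]

/-- An element which is central modulo `I` lies in `I` as soon as its product with `ψ_{w_0}`
does. -/
theorem mem_of_mul_psiPerm_longest_mem {I : TwoSidedIdeal (Alg K n)} {x : Alg K n}
    (hx : ∀ h, x * h - h * x ∈ I) (h : x * psiPerm K (longest n) ∈ I) : x ∈ I := by
  let T : TwoSidedIdeal (Alg K n) := TwoSidedIdeal.mk' {a | x * a ∈ I}
    (by simp)
    (fun {a b} ha hb => by
      change x * (a + b) ∈ I
      rw [mul_add]
      exact I.add_mem ha hb)
    (fun {a} ha => by
      have h1 : x * -a = -(x * a) := mul_neg x a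
      change x * -a ∈ I
      exact h1 ▸ I.neg_mem ha)
    (fun {a b} hb => by
      have h1 := I.add_mem (I.mul_mem_right _ b (hx a)) (I.mul_mem_left a _ hb)
      rwa [sub_mul, mul_assoc, mul_assoc, sub_add_cancel] at h1)
    (fun {a b} ha => by
      change x * (a * b) ∈ I
      rw [← mul_assoc]
      exact I.mul_mem_right _ _ ha)
  have h1 : (1 : Alg K n) ∈ T := one_mem_of_psiPerm_longest_mem
    ((TwoSidedIdeal.mem_mk' _ _ _ _ _ _ _).2 h)
  have h2 := (TwoSidedIdeal.mem_mk' _ _ _ _ _ _ _).1 h1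
  change x * 1 ∈ I at h2
  rwa [mul_one] at h2

end Longest

/-! ### The cyclotomic quotient and its center -/

section Cyclotomic

open MvPolynomial

variable {K : Type*} [Field K] {n ℓ : ℕ}

theorem addDelta_rho_lt (lam : Tuples n ℓ) (i : Fin n) : addDelta (rho lam).1 i < ℓ := by
  have h1 := rho_val lam i
  have h2 := (lam.2.2 i).1
  have h3 := i.isLt
  simp only [addDelta]
  omega

variable [NeZero n]

theorem proj_surjective : Function.Surjective (proj K n ℓ) :=
  (cycIdeal K n ℓ).ringCon.mkₐ_surjective (α := K)

theorem proj_eq_zero_iff (h : Alg K n) : proj K n ℓ h = 0 ↔ h ∈ cycIdeal K n ℓ := by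
  rw [TwoSidedIdeal.mem_iff, ← RingCon.eq]
  rfl

theorem proj_eq_proj_iff (h h' : Alg K n) :
    proj K n ℓ h = proj K n ℓ h' ↔ h - h' ∈ cycIdeal K n ℓ := by
  rw [← proj_eq_zero_iff, map_sub, sub_eq_zero]

theorem proj_pol (f : MvPolynomial (Fin n) K) :
    proj K n ℓ (pol K n f) = evalAt (cycY K ℓ) f := by
  have h : (fun i => ((proj K n ℓ).comp (pol K n)) (X i)) = cycY K ℓ := funext fun i => by
    rw [AlgHom.comp_apply, pol_X, cycY]
  rw [← h]
  exact algHom_eq_evalAt ((proj K n ℓ).comp (pol K n)) f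

theorem proj_pol_mem_center {f : MvPolynomial (Fin n) K} (hf : f.IsSymmetric) :
    proj K n ℓ (pol K n f) ∈ Subalgebra.center K (CycAlg K n ℓ) := by
  rw [Subalgebra.mem_center_iff]
  intro b
  obtain ⟨h, rfl⟩ := proj_surjective b
  rw [← map_mul, ← map_mul, pol_commute hf]

/-- The alternating sums `∑_w sgn(w) w(f · h(g))` for `h` in the ideal generated by `y_1 ^ ℓ` are
combinations of alternants with an exponent `≥ ℓ`, hence contain no monomial with all exponents
less than `ℓ`. -/
theorem coeff_alt_of_mem_cycIdeal {h : Alg K n} (hh : h ∈ cycIdeal K n ℓ) {d : Fin n → ℕ}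
    (hd : ∀ j, d j < ℓ) (f g : MvPolynomial (Fin n) K) :
    coeff (Finsupp.equivFunOnFinite.symm d) (alt K n (f * rep K n h g)) = 0 := by
  let T : TwoSidedIdeal (Alg K n) := TwoSidedIdeal.mk'
    {a | ∀ f g, coeff (Finsupp.equivFunOnFinite.symm d) (alt K n (f * rep K n a g)) = 0}
    (fun f g => by simp)
    (fun {a b} ha hb f g => by
      rw [map_add, LinearMap.add_apply, mul_add, map_add, coeff_add, ha, hb, add_zero])
    (fun {a} ha f g => by
      have h1 : rep K n (-a) = -rep K n a := map_neg _ _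
      have h2 := ha f g
      simp only [h1, LinearMap.neg_apply, mul_neg, map_neg, coeff_neg, h2, neg_zero])
    (fun {a b} hb f g => by
      rw [map_mul (rep K n), Module.End.mul_apply, alt_mul_rep]
      exact hb _ _)
    (fun {a b} ha f g => by
      rw [map_mul (rep K n), Module.End.mul_apply]
      exact ha _ _)
  have hle : cycIdeal K n ℓ ≤ T := by
    refine TwoSidedIdeal.span_le.2 (Set.singleton_subset_iff.2 ?_)
    refine (TwoSidedIdeal.mem_mk' _ _ _ _ _ _ _).2 fun f g => ?_
    rw [← pol_X, ← map_pow, rep_pol, mul_left_comm]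
    induction f * g using mono_induction with
    | hmono c =>
      have h1 : (X 0 ^ ℓ : MvPolynomial (Fin n) K) = mono K (Pi.single 0 ℓ) := by
        rw [mono, Finset.prod_eq_single 0]
        · simp
        · intro i _ hi
          simp [hi]
        · simp
      rw [h1, ← mono_add, alt_mono]
      exact coeff_alternant_of_le (i := 0) (by simp) hd
    | hadd f g hf hg => rw [mul_add, map_add, coeff_add, hf, hg, add_zero]
    | hsmul a f hf => rw [mul_smul_comm, map_smul, coeff_smul, hf, smul_zero]
  exact (TwoSidedIdeal.mem_mk' _ _ _ _ _ _ _).1 (hle hh) f g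

/-- Every central element of the cyclotomic quotient is the image of a symmetric polynomial. -/
theorem exists_symmetric_of_mem_center {z : CycAlg K n ℓ}
    (hz : z ∈ Subalgebra.center K (CycAlg K n ℓ)) :
    ∃ q : MvPolynomial (Fin n) K, q.IsSymmetric ∧ proj K n ℓ (pol K n q) = z := by
  obtain ⟨x, rfl⟩ := proj_surjective z
  rw [Subalgebra.mem_center_iff] at hz
  set e := psiPerm K (longest n) with he
  set m := pol K n (mono K (addDelta (0 : Fin n → ℕ))) with hm
  obtain ⟨q, hq, hq'⟩ := psiPerm_longest_mul_mul (x * m)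
  rw [← he] at hq'
  have hemm : e * m * e = ((-1) ^ (n * (n - 1) / 2) : K) • e := by
    have h := psiPerm_longest_mul_addDelta_mul (K := K) (zeroPartition n)
    rw [schur_zero, map_one, mul_one] at h
    exact h
  set c : K := (-1) ^ (n * (n - 1) / 2) with hc
  have hcc : c * c = 1 := by rw [hc, ← mul_pow, neg_one_mul, neg_neg, one_pow]
  refine ⟨c • q, fun w => by rw [map_smul, hq w], ?_⟩
  have hcq : ∀ h, pol K n (c • q) * h = h * pol K n (c • q) := fun h => by
    rw [map_smul, smul_mul_assoc, mul_smul_comm, pol_commute hq]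
  refine ((proj_eq_proj_iff _ _).2 (mem_of_mul_psiPerm_longest_mem (fun h => ?_) ?_)).symm
  · rw [← proj_eq_proj_iff, sub_mul, mul_sub, hcq, map_sub, map_sub, map_mul, ← hz, ← map_mul]
  · rw [← he, sub_mul, ← proj_eq_proj_iff]
    -- `x e = ± x e m e = ± e x m e` in the quotient
    have h1 : e = c • (e * m * e) := by rw [hemm, smul_smul, hcc, one_smul]
    have h2 : proj K n ℓ (x * (e * m * e)) = proj K n ℓ (e * (x * m) * e) := by
      simp only [map_mul, ← mul_assoc]
      rw [hz]
    conv_lhs => rw [h1, mul_smul_comm, map_smul, h2, hq', ← map_smul, ← mul_smul_comm, ← map_smul,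
      ← hcq]

/-- Schur polynomials of partitions with first part exceeding `ℓ - n` vanish in the cyclotomic
quotient: `y_1 ^ ℓ` divides `y^{μ + δ}`. -/
theorem pol_schur_mem_cycIdeal {μ : Partitions n} (hμ : ℓ ≤ addDelta μ.1 0) :
    pol K n (schur K μ) ∈ cycIdeal K n ℓ := by
  have hcomm := pol_commute (schur_isSymmetric (K := K) μ)
  refine mem_of_mul_psiPerm_longest_mem (fun h => ?_) ?_
  · rw [hcomm, sub_self]
    exact TwoSidedIdeal.zero_mem _
  · have h1 : pol K n (mono K (addDelta μ.1)) ∈ cycIdeal K n ℓ := by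
      obtain ⟨c, hc⟩ : (X 0 ^ ℓ : MvPolynomial (Fin n) K) ∣ mono K (addDelta μ.1) :=
        (pow_dvd_pow _ hμ).trans (Finset.dvd_prod_of_mem _ (Finset.mem_univ 0))
      rw [hc, map_mul, map_pow, pol_X]
      exact TwoSidedIdeal.mul_mem_right _ _ _ (TwoSidedIdeal.subset_span rfl)
    have h2 := psiPerm_longest_mul_addDelta_mul (K := K) μ
    have h3 := TwoSidedIdeal.mul_mem_right _ _ (psiPerm K (longest n))
      (TwoSidedIdeal.mul_mem_left _ (psiPerm K (longest n)) _ h1)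
    have h4 := TwoSidedIdeal.mul_mem_left _ (algebraMap K _ ((-1) ^ (n * (n - 1) / 2))) _ h3
    rwa [h2, ← Algebra.smul_def, smul_smul, ← mul_pow, neg_one_mul, neg_neg, one_pow, one_smul,
      ← hcomm] at h4

/-- The partitions `ρ(λ)` are those with first part at most `ℓ - n`. -/
theorem exists_rho_eq {μ : Partitions n} (hμ : addDelta μ.1 0 < ℓ) :
    ∃ lam : Tuples n ℓ, rho lam = μ := by
  have hs := addDelta_strictAnti μ.2
  have hlt : ∀ i, addDelta μ.1 i < ℓ := fun i => (hs.antitone (Fin.zero_le i)).trans_lt hμ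
  refine ⟨⟨fun i => ℓ - addDelta μ.1 i, fun i j hij => ?_, fun i => ?_⟩, ?_⟩
  · have h1 := hs hij
    have h2 := hlt i
    simp only
    omega
  · have h1 := hlt i
    simp only
    omega
  · refine Subtype.ext (funext fun i => ?_)
    have h1 := hlt i
    have h2 := i.isLt
    simp only [rho]
    simp only [addDelta] at h1 ⊢
    omega

/-- If a combination of the `s_{ρ(λ)}` vanishes in the cyclotomic quotient, compare coefficients
after multiplication with `a_δ`. -/
theorem linearIndependent_schur :
    LinearIndependent K fun lam : Tuples n ℓ => proj K n ℓ (pol K n (schur K (rho lam))) := by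
  classical
  rw [linearIndependent_iff']
  intro s k hk lam hlam
  have h1 : pol K n (∑ ν ∈ s, k ν • schur K (rho ν)) ∈ cycIdeal K n ℓ := by
    rw [← proj_eq_zero_iff, ← hk]
    simp only [map_sum, map_smul]
  have h2 := coeff_alt_of_mem_cycIdeal h1 (addDelta_rho_lt lam) (mono K (addDelta 0)) 1
  have h3 : (∑ ν ∈ s, k ν • schur K (rho ν)).IsSymmetric := fun w => by
    simp only [map_sum, map_smul, schur_isSymmetric _ w]
  rw [rep_pol, mul_one, alt_mul_of_isSymmetric _ h3, alt_mono, Finset.mul_sum, coeff_sum] at h2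
  simp only [mul_smul_comm, ← schur_spec, coeff_smul, coeff_alternant_addDelta,
    rho_injective.eq_iff] at h2
  simpa [hlam] using h2

theorem mem_span_schur_of_mem_center {z : CycAlg K n ℓ}
    (hz : z ∈ Subalgebra.center K (CycAlg K n ℓ)) :
    z ∈ Submodule.span K
      (Set.range fun lam : Tuples n ℓ => proj K n ℓ (pol K n (schur K (rho lam)))) := by
  obtain ⟨q, hq, rfl⟩ := exists_symmetric_of_mem_center hz
  have h := Submodule.mem_map_of_mem (f := ((proj K n ℓ).comp (pol K n)).toLinearMap)
    (mem_span_schur hq)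
  rw [Submodule.map_span] at h
  refine Submodule.span_le.2 ?_ h
  rintro _ ⟨_, ⟨μ, rfl⟩, rfl⟩
  rcases lt_or_ge (addDelta μ.1 0) ℓ with h | h
  · obtain ⟨lam, rfl⟩ := exists_rho_eq h
    exact Submodule.subset_span ⟨lam, rfl⟩
  · change proj K n ℓ (pol K n (schur K μ)) ∈ Submodule.span K _
    rw [(proj_eq_zero_iff _).2 (pol_schur_mem_cycIdeal h)]
    exact Submodule.zero_mem _

end Cyclotomic

end NilHecke

end

theorem corollary2p15 {K : Type*} [Field K] (ℓ n : ℕ) [NeZero n] (hn : n ≤ ℓ) :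
    (∀ lam : NilHecke.Tuples n ℓ,
      (∃! z : NilHecke.Alg K n,
        NilHecke.IsSymmPart K (NilHecke.S K (NilHecke.rho lam)) z) ∧
      NilHecke.zCyc K ℓ (NilHecke.rho lam) =
        NilHecke.evalAt (NilHecke.cycY K ℓ) (NilHecke.schur K (NilHecke.rho lam))) ∧
    ∃ b : Module.Basis (NilHecke.Tuples n ℓ) K
        (Subalgebra.center K (NilHecke.CycAlg K n ℓ)),
      ∀ lam : NilHecke.Tuples n ℓ,
        (b lam : NilHecke.CycAlg K n ℓ) =
          NilHecke.evalAt (NilHecke.cycY K ℓ) (NilHecke.schur K (NilHecke.rho lam)) := by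
  refine ⟨fun lam => ⟨⟨_, NilHecke.isSymmPart_schur _, fun z hz =>
    hz.unique (NilHecke.isSymmPart_schur _)⟩, ?_⟩, ?_⟩
  · rw [NilHecke.zCyc, NilHecke.zPart_eq, NilHecke.proj_pol]
  · let v : NilHecke.Tuples n ℓ → Subalgebra.center K (NilHecke.CycAlg K n ℓ) := fun lam =>
      ⟨_, NilHecke.proj_pol_mem_center (NilHecke.schur_isSymmetric (NilHecke.rho lam))⟩
    have hli : LinearIndependent K v :=
      LinearIndependent.of_comp (Subalgebra.center K (NilHecke.CycAlg K n ℓ)).val.toLinearMap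
        NilHecke.linearIndependent_schur
    have hspan : ⊤ ≤ Submodule.span K (Set.range v) := by
      rintro z -
      have h := NilHecke.mem_span_schur_of_mem_center z.2
      have hv : (Set.range fun lam : NilHecke.Tuples n ℓ =>
          NilHecke.proj K n ℓ (NilHecke.pol K n (NilHecke.schur K (NilHecke.rho lam)))) =
          (Subalgebra.center K (NilHecke.CycAlg K n ℓ)).val.toLinearMap '' Set.range v := by
        rw [← Set.range_comp]
        rfl
      rw [hv, ← Submodule.map_span] at h
      obtain ⟨w, hw, hwz⟩ := h
      rwa [← Subtype.ext hwz]
    refine ⟨Module.Basis.mk hli hspan, fun lam => ?_⟩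
    rw [Module.Basis.mk_apply, ← NilHecke.proj_pol]
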